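/- **Setting.** For $k_F>0$ let $B_F=\{p\in\mathbb Z^3:|p|\le k_F\}$, $B_F^c=\mathbb Z^3\setminus B_F$, $N=|B_F|$, $\hbar=N^{-1/3}$, $\kappa=k_FN^{-1/3}$. Let $\mathcal F$ be the fermionic Fock space over $L^2(\mathbb T^3)$, $\mathbb T^3=\mathbb R^3/(2\pi\mathbb Z^3)$, and let $a_p^*,a_p$ be the creation and annihilation operators of the plane waves with momentum $p\in\mathbb Z^3$. Put $\mathcal N=\sum_p a_p^*a_p$, $\mathcal N_h=\sum_{h\in B_F}a_h^*a_h$, $\mathcal N_p=\sum_{p\in B_F^c}a_p^*a_p$, $\mathcal N_\delta=\sum_{p:\,||p|-k_F|>N^{-\delta}}a_p^*a_p$ for $\delta>0$, and $$\mathbb H_0=\sum_{p\in\mathbb Z^3}|\hbar^2p^2-\kappa^2|\,a_p^*a_p,\qquad b(k)=\sum_{p\in B_F^c\cap(B_F+k)}a_{p-k}a_p,$$ $$d^*(k)=\sum_{p\in B_F^c\cap(B_F^c+k)}a_p^*a_{p-k}-\sum_{h\in B_F\cap(B_F-k)}a_h^*a_{h+k},$$ and, for a function $\hat V:\mathbb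 Z^3\to\mathbb R$ (the Fourier coefficients of the interaction potential), $$\mathcal E_1=\frac1{2N}\sum_{k\in\mathbb Z^3}\hat V(k)\,d^*(k)d(k),\qquad \mathcal E_2=\frac1{2N}\sum_{k\in\mathbb Z^3}\hat V(k)\big[d^*(k)b(-k)+\text{h.c.}\big].$$ Operator inequalities and expectation values are understood in the sense of quadratic forms. **Statement.** (i) Assume $\|\hat V\|_1=\sum_k|\hat V(k)|<\infty$ and $\hat V\ge0$. There is a constant $C>0$, depending only on $\hat V$, such that for all $k_F>0$ and all $\alpha\ge0$ $$\pm\mathcal E_2\le N^\alpha\mathcal E_1+CN^{-\alpha}\mathbb H_0$$ on all $\xi\in\mathcal F$ in the form domains of $\mathcal E_1$ and $\mathbb H_0$; in particular the series over $k$ defining $\langle\xi,\mathcal E_2\xi\rangle$ converges absolutely for such $\xi$. (ii) For every $\gamma$ with $131/208<\gamma<1$ there is $\varepsilon_0>0$ such that for every $0<\varepsilon<\varepsilon_0$ and every $\hat V\ge0$ with $\|\hat V\|_1<\infty$ there is a constant $C>0$ (depending on $\gamma,\varepsilon,\hat V$) such that, for all $k_F>0$ and all $\xi\in\chi(\mathcal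 N_h-\mathcal N_p=0)\mathcal F$ in the form domain of $\mathbb H_0$, the series for $\langle\xi,\mathcal E_1\xi\rangle$ and $\langle\xi,\mathcal E_2\xi\rangle$ converge absolutely and $$\langle\xi,(\mathcal E_1+\mathcal E_2)\xi\rangle\ \ge\ -CN^{-1+\varepsilon/4}\,\|(\mathcal N+1)^{3/2}\xi\|\,\|\mathcal N_{1/3-\varepsilon}^{1/2}\xi\|-CN^{5\varepsilon/4+\gamma/3-1}\,\|\mathcal N^{1/2}\xi\|^2-CN^{-\varepsilon/4}\,\|\mathbb H_0^{1/2}\xi\|^2 .$$ -/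

import Mathlib

open scoped InnerProductSpace

noncomputable section

namespace FermiGas

/-! ### Momenta and the Fermi ball -/

/-- Momenta on the torus of side `2π`: the lattice `ℤ³`. -/
abbrev Momentum := Fin 3 → ℤ

/-- The Euclidean length `|p|`. -/
def len (p : Momentum) : ℝ := √(∑ i, (p i : ℝ) ^ 2)

lemma fermiBall_finite (kF : ℝ) : {p : Momentum | len p ≤ kF}.Finite := by
  refine (Set.Finite.pi' (fun _ : Fin 3 => Set.finite_Icc (-⌈kF⌉) ⌈kF⌉)).subset ?_
  intro p hp i
  have h1 : |(p i : ℝ)| ≤ kF := by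
    refine le_trans ?_ hp
    rw [← Real.sqrt_sq_eq_abs]
    exact Real.sqrt_le_sqrt
      (Finset.single_le_sum (f := fun j => (p j : ℝ) ^ 2) (fun j _ => sq_nonneg _)
        (Finset.mem_univ i))
  have h2 := abs_le.1 (h1.trans (Int.le_ceil kF))
  constructor
  · exact_mod_cast h2.1
  · exact_mod_cast h2.2

/-- The Fermi ball `B_F = {p ∈ ℤ³ : |p| ≤ k_F}`. -/
def fermiBall (kF : ℝ) : Finset Momentum := (fermiBall_finite kF).toFinset

/-- The particle number `N = |B_F|`. -/
def particleNumber (kF : ℝ) : ℕ := (fermiBall kF).card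

/-- The effective Planck constant `ħ = N^{-1/3}`. -/
def hbar (kF : ℝ) : ℝ := (particleNumber kF : ℝ) ^ (-(1 / 3) : ℝ)

/-- The number `κ` determined by `k_F = κ N^{1/3}`. -/
def kappa (kF : ℝ) : ℝ := kF / (particleNumber kF : ℝ) ^ (1 / 3 : ℝ)

/-- The excitation energy `e(p) = |ħ² p² - κ²|`. -/
def excitationEnergy (kF : ℝ) (p : Momentum) : ℝ :=
  |hbar kF ^ 2 * len p ^ 2 - kappa kF ^ 2|

/-! ### Fermionic Fock space over `L²(𝕋³)`, in occupation number representation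

The Slater determinants `⋀_{p ∈ S} f_p` of plane waves, `S` running over the finite subsets of
`ℤ³` and the factors being arranged in lexicographic order, form an orthonormal basis of the
fermionic Fock space. A vector is identified with the square summable family of its coefficients
in this basis. -/

/-- Fermionic Fock space. -/
abbrev Fock := lp (fun _ : Finset Momentum => ℂ) 2

/-- The vacuum vector. -/
def vacuum : Fock := lp.single 2 (∅ : Finset Momentum) (1 : ℂ)

/-- The lexicographic order of the momenta. -/
def Precedes (p q : Momentum) : Prop := toLex p < toLex q

lemma not_precedes_self (p : Momentum) : ¬ Precedes p p := lt_irrefl (toLex p)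

lemma precedes_or {p q : Momentum} (h : p ≠ q) :
    (Precedes p q ∧ ¬ Precedes q p) ∨ (Precedes q p ∧ ¬ Precedes p q) := by
  rcases lt_or_gt_of_ne (toLex.injective.ne h) with h | h
  · exact Or.inl ⟨h, lt_asymm h⟩
  · exact Or.inr ⟨h, lt_asymm h⟩

open Classical in
/-- The sign picked up when the plane wave `f_p` is moved to its place among those in `S`. -/
def fermiSign (p : Momentum) (S : Finset Momentum) : ℂ :=
  (-1) ^ (S.filter (fun q => Precedes q p)).card

lemma norm_fermiSign (p : Momentum) (S : Finset Momentum) : ‖fermiSign p S‖ = 1 := by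
  simp [fermiSign]

lemma fermiSign_mul_self (p : Momentum) (S : Finset Momentum) :
    fermiSign p S * fermiSign p S = 1 := by
  simp [fermiSign, ← mul_pow]

lemma star_fermiSign (p : Momentum) (S : Finset Momentum) :
    star (fermiSign p S) = fermiSign p S := by
  simp [fermiSign]

/-- The coefficients of `a_p ξ`. -/
def annihilateFun (p : Momentum) (ξ : Finset Momentum → ℂ) : Finset Momentum → ℂ :=
  fun S => if p ∈ S then 0 else fermiSign p S * ξ (insert p S)

lemma insert_injOn (p : Momentum) :
    Function.Injective (fun S : {S : Finset Momentum // p ∉ S} => insert p S.1) := by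
  intro S T h
  apply Subtype.ext
  rw [← Finset.erase_insert S.2, ← Finset.erase_insert T.2]
  exact congrArg (fun U => Finset.erase U p) h

lemma norm_annihilateFun_sq (p : Momentum) (ξ : Finset Momentum → ℂ) :
    (fun S => ‖annihilateFun p ξ S‖ ^ 2) =
      Set.indicator {S : Finset Momentum | p ∉ S} (fun S => ‖ξ (insert p S)‖ ^ 2) := by
  funext S
  by_cases h : p ∈ S <;> simp [annihilateFun, h, norm_fermiSign]

lemma summable_fock (ξ : Fock) : Summable (fun S => ‖ξ S‖ ^ 2) := by
  have h := (lp.memℓp ξ).summable (by norm_num)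
  simpa using h

lemma norm_sq_fock (ξ : Fock) : ‖ξ‖ ^ 2 = ∑' S, ‖ξ S‖ ^ 2 := by
  have h := lp.norm_rpow_eq_tsum (p := 2) (by norm_num) ξ
  simpa using h

lemma memℓp_two {f : Finset Momentum → ℂ} (h : Summable (fun S => ‖f S‖ ^ 2)) :
    Memℓp f 2 := by
  refine memℓp_gen ?_
  simpa using h

lemma summable_annihilateFun (p : Momentum) (ξ : Fock) :
    Summable (fun S => ‖annihilateFun p ξ S‖ ^ 2) := by
  rw [norm_annihilateFun_sq]
  exact (summable_subtype_iff_indicator (s := {S : Finset Momentum | p ∉ S})).1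
    ((summable_fock ξ).comp_injective (insert_injOn p))

lemma tsum_annihilateFun_le (p : Momentum) (ξ : Fock) :
    ∑' S, ‖annihilateFun p ξ S‖ ^ 2 ≤ ∑' S, ‖ξ S‖ ^ 2 := by
  rw [norm_annihilateFun_sq, ← tsum_subtype]
  exact tsum_comp_le_tsum_of_inj (summable_fock ξ) (fun S => sq_nonneg _) (insert_injOn p)

/-- The annihilation operator `a_p` of the plane wave with momentum `p`. -/
def annihilate (p : Momentum) : Fock →L[ℂ] Fock :=
  LinearMap.mkContinuous
    { toFun := fun ξ => ⟨annihilateFun p ξ, memℓp_two (summable_annihilateFun p ξ)⟩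
      map_add' := by
        intro ξ η
        ext S
        change annihilateFun p (ξ + η : Fock) S = annihilateFun p ξ S + annihilateFun p η S
        by_cases h : p ∈ S <;> simp [annihilateFun, h, mul_add]
      map_smul' := by
        intro c ξ
        ext S
        change annihilateFun p (c • ξ : Fock) S = c * annihilateFun p ξ S
        by_cases h : p ∈ S <;> simp [annihilateFun, h, mul_left_comm] }
    1 (by
      intro ξ
      rw [one_mul]
      refine le_of_sq_le_sq ?_ (norm_nonneg _)
      rw [norm_sq_fock, norm_sq_fock]
      exact tsum_annihilateFun_le p ξ)

/-- The creation operator `a_p^*`. -/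
def create (p : Momentum) : Fock →L[ℂ] Fock := ContinuousLinearMap.adjoint (annihilate p)

lemma annihilate_apply (p : Momentum) (ξ : Fock) (S : Finset Momentum) :
    annihilate p ξ S = if p ∈ S then 0 else fermiSign p S * ξ (insert p S) := rfl

lemma fermiSign_insert_self (p : Momentum) (S : Finset Momentum) :
    fermiSign p (insert p S) = fermiSign p S := by
  simp [fermiSign, Finset.filter_insert, not_precedes_self]

lemma annihilate_single (p : Momentum) (S : Finset Momentum) :
    annihilate p (lp.single 2 S (1 : ℂ)) =
      if p ∈ S then lp.single 2 (S.erase p) (fermiSign p S) else 0 := by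
  ext T
  rw [annihilate_apply]
  by_cases hT : p ∈ T
  · rw [if_pos hT]
    split_ifs with hS
    · have hne : T ≠ S.erase p := by rintro rfl; simp at hT
      simp [lp.single_apply, hne]
    · rfl
  · rw [if_neg hT]
    split_ifs with hS
    · by_cases hTS : T = S.erase p
      · subst hTS
        rw [Finset.insert_erase hS, lp.single_apply_self, lp.single_apply_self, mul_one,
          ← fermiSign_insert_self, Finset.insert_erase hS]
      · have h2 : insert p T ≠ S := by
          rintro rfl
          exact hTS (Finset.erase_insert hT).symm
        simp [lp.single_apply, hTS, h2]
    · have h2 : insert p T ≠ S := by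
        rintro rfl
        simp at hS
      simp [lp.single_apply, h2]

lemma create_apply (p : Momentum) (ξ : Fock) (S : Finset Momentum) :
    create p ξ S = if p ∈ S then fermiSign p S * ξ (S.erase p) else 0 := by
  have h1 : create p ξ S = ⟪lp.single 2 S (1 : ℂ), create p ξ⟫_ℂ := by
    rw [lp.inner_single_left]
    simp
  rw [h1, create, ContinuousLinearMap.adjoint_inner_right, annihilate_single]
  split_ifs with h
  · rw [lp.inner_single_left]
    have := star_fermiSign p S
    simp only [RCLike.star_def] at this
    simp [this, mul_comm]
  · simp

lemma create_annihilate_apply (p : Momentum) (ξ : Fock) (S : Finset Momentum) :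
    create p (annihilate p ξ) S = if p ∈ S then ξ S else 0 := by
  rw [create_apply]
  split_ifs with h
  · rw [annihilate_apply, if_neg (Finset.notMem_erase p S), Finset.insert_erase h, ← mul_assoc,
      ← fermiSign_insert_self p (S.erase p), Finset.insert_erase h, fermiSign_mul_self, one_mul]
  · rfl

lemma annihilate_vacuum (p : Momentum) : annihilate p vacuum = 0 := by
  ext S
  simp [annihilate_apply, vacuum]

open Classical in
lemma fermiSign_insert {p q : Momentum} {S : Finset Momentum} (hp : p ∉ S) :
    fermiSign q (insert p S) = (if Precedes p q then -1 else 1) * fermiSign q S := by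
  unfold fermiSign
  rw [Finset.filter_insert]
  split_ifs with h
  · rw [Finset.card_insert_of_notMem (by simp [hp]), pow_succ']
  · rw [one_mul]

/-- Canonical anticommutation relations, first part. -/
lemma annihilate_annihilate (p q : Momentum) (ξ : Fock) :
    annihilate p (annihilate q ξ) + annihilate q (annihilate p ξ) = 0 := by
  ext S
  change annihilate p (annihilate q ξ) S + annihilate q (annihilate p ξ) S = 0
  simp only [annihilate_apply]
  rcases eq_or_ne p q with rfl | hpq
  · simp
  by_cases hp : p ∈ S
  · simp [hp]
  by_cases hq : q ∈ S
  · simp [hq]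
  rw [if_neg hp, if_neg hq, if_neg (by simp [hpq.symm, hq]), if_neg (by simp [hpq, hp]),
    fermiSign_insert hp, fermiSign_insert hq, Finset.insert_comm q p]
  rcases precedes_or hpq with ⟨h, h2⟩ | ⟨h, h2⟩
  · rw [if_pos h, if_neg h2]; ring
  · rw [if_pos h, if_neg h2]; ring

/-- Canonical anticommutation relations, second part. -/
lemma annihilate_create (p q : Momentum) (ξ : Fock) :
    annihilate p (create q ξ) + create q (annihilate p ξ) = if p = q then ξ else 0 := by
  ext S
  change annihilate p (create q ξ) S + create q (annihilate p ξ) S = _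
  rcases eq_or_ne p q with rfl | hpq
  · rw [create_annihilate_apply, annihilate_apply, create_apply, if_pos rfl]
    by_cases hp : p ∈ S
    · simp [hp]
    · rw [if_neg hp, if_neg hp, if_pos (Finset.mem_insert_self p S), Finset.erase_insert hp,
        fermiSign_insert_self, ← mul_assoc, fermiSign_mul_self, one_mul, add_zero]
  · rw [if_neg hpq, annihilate_apply, create_apply, create_apply, annihilate_apply]
    change _ = (0 : ℂ)
    by_cases hq : q ∈ S
    · by_cases hp : p ∈ S
      · simp [hp, hpq]
      · obtain ⟨T, hqT, rfl⟩ : ∃ T, q ∉ T ∧ S = insert q T :=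
          ⟨S.erase q, by simp, (Finset.insert_erase hq).symm⟩
        have hpT : p ∉ T := fun h => hp (Finset.mem_insert_of_mem h)
        rw [if_neg hp, if_pos (by simp), if_pos hq, Finset.erase_insert hqT, if_neg hpT,
          Finset.insert_comm p q, Finset.erase_insert (by simp [hpq.symm, hqT]),
          fermiSign_insert_self, fermiSign_insert_self, fermiSign_insert hqT,
          fermiSign_insert hpT]
        rcases precedes_or hpq with ⟨h, h2⟩ | ⟨h, h2⟩
        · rw [if_pos h, if_neg h2]; ring
        · rw [if_pos h, if_neg h2]; ring
    · simp [hq, hpq.symm]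

/-! ### The operators of the correlation Hamiltonian

An inequality between operators is an inequality between their quadratic forms. -/

/-- The set `B_F^c ∩ (B_F + k)`. -/
def lune (kF : ℝ) (k : Momentum) : Finset Momentum :=
  ((fermiBall kF).image (fun h => h + k)).filter (fun p => p ∉ fermiBall kF)

/-- The pair operator `b(k) = ∑ a_{p-k} a_p` over `p ∈ B_F^c ∩ (B_F + k)`. -/
def pairOp (kF : ℝ) (k : Momentum) : Fock →L[ℂ] Fock :=
  ∑ p ∈ lune kF k, annihilate (p - k) ∘L annihilate p

/-- The coefficients of `d(k) ξ` in the basis of Slater determinants, where `d(k)` is the adjoint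
of `d^*(k) = ∑ a_p^* a_{p-k} - ∑ a_h^* a_{h+k}`, that is,
`d(k) = ∑ a_{p-k}^* a_p - ∑ a_{h+k}^* a_h`, with `p ∈ B_F^c ∩ (B_F^c + k)` and
`h ∈ B_F ∩ (B_F - k)`. For each coefficient only finitely many terms are nonzero. -/
def nonBosonizableFun (kF : ℝ) (k : Momentum) (ξ : Fock) : Finset Momentum → ℂ := fun S =>
  (∑' p : {p : Momentum // p ∉ fermiBall kF ∧ p - k ∉ fermiBall kF},
      create (p.1 - k) (annihilate p.1 ξ) S)
    - ∑ h ∈ fermiBall kF with h + k ∈ fermiBall kF, create (h + k) (annihilate h ξ) S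

/-- The (maximal) domain of `d(k)`. -/
def nonBosonizableDomain (kF : ℝ) (k : Momentum) : Set Fock :=
  {ξ | Memℓp (nonBosonizableFun kF k ξ) 2}

open Classical in
/-- The vector `d(k) ξ`, for `ξ` in the domain of `d(k)` (and `0` otherwise). -/
def nonBosonizable (kF : ℝ) (k : Momentum) (ξ : Fock) : Fock :=
  if h : Memℓp (nonBosonizableFun kF k ξ) 2 then ⟨nonBosonizableFun kF k ξ, h⟩ else 0

/-- The form domain of `ℰ₁`: the vectors on which all the operators `d(k)` that occur in `ℰ₁` are
defined and `⟨ξ, ℰ₁ ξ⟩` is finite. -/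
def E1Domain (V : Momentum → ℝ) (kF : ℝ) : Set Fock :=
  {ξ | (∀ k, V k ≠ 0 → ξ ∈ nonBosonizableDomain kF k) ∧
    Summable (fun k => V k * ‖nonBosonizable kF k ξ‖ ^ 2)}

/-- `⟨ξ, ℰ₁ ξ⟩`, where `ℰ₁ = (2N)⁻¹ ∑ V̂(k) d^*(k) d(k)`. -/
def E1Form (V : Momentum → ℝ) (kF : ℝ) (ξ : Fock) : ℝ :=
  1 / (2 * (particleNumber kF : ℝ)) * ∑' k, V k * ‖nonBosonizable kF k ξ‖ ^ 2

/-- `⟨ξ, (d^*(k) b(-k) + h.c.) ξ⟩ = ⟨d(k) ξ, b(-k) ξ⟩ + ⟨b(-k) ξ, d(k) ξ⟩`. -/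
def couplingForm (kF : ℝ) (k : Momentum) (ξ : Fock) : ℝ :=
  2 * (⟪nonBosonizable kF k ξ, pairOp kF (-k) ξ⟫_ℂ).re

/-- `⟨ξ, ℰ₂ ξ⟩`, where `ℰ₂ = (2N)⁻¹ ∑ V̂(k) [d^*(k) b(-k) + h.c.]`. -/
def E2Form (V : Momentum → ℝ) (kF : ℝ) (ξ : Fock) : ℝ :=
  1 / (2 * (particleNumber kF : ℝ)) * ∑' k, V k * couplingForm kF k ξ

/-- The form domain of the kinetic energy `ℍ₀ = ∑ e(p) a_p^* a_p`. -/
def kineticDomain (kF : ℝ) : Set Fock :=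
  {ξ | Summable (fun p => excitationEnergy kF p * ‖annihilate p ξ‖ ^ 2)}

/-- `⟨ξ, ℍ₀ ξ⟩ = ‖ℍ₀^{1/2} ξ‖²`. -/
def kineticForm (kF : ℝ) (ξ : Fock) : ℝ :=
  ∑' p, excitationEnergy kF p * ‖annihilate p ξ‖ ^ 2

/-- `⟨ξ, 𝒩 ξ⟩ = ‖𝒩^{1/2} ξ‖²` for the number operator `𝒩 = ∑ a_p^* a_p`. -/
def numberForm (ξ : Fock) : ℝ := ∑' p, ‖annihilate p ξ‖ ^ 2

/-- `⟨ξ, 𝒩_δ ξ⟩ = ‖𝒩_δ^{1/2} ξ‖²` for the gapped number operator `𝒩_δ = ∑ a_p^* a_p`, the sum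
running over the momenta with `||p| - k_F| > N^{-δ}`. -/
def gappedNumberForm (kF δ : ℝ) (ξ : Fock) : ℝ :=
  ∑' p : {p : Momentum // (particleNumber kF : ℝ) ^ (-δ) < |len p - kF|}, ‖annihilate p.1 ξ‖ ^ 2

/-- `‖(𝒩 + 1)^{3/2} ξ‖² = ⟨ξ, (𝒩 + 1)³ ξ⟩`; the number operator is diagonal in the basis of Slater
determinants, with the eigenvalue `|S|` on the one with momenta `S`. -/
def numberCubedForm (ξ : Fock) : ℝ := ∑' S : Finset Momentum, ((S.card : ℝ) + 1) ^ 3 * ‖ξ S‖ ^ 2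

/-- The eigenspace `χ(𝒩_h - 𝒩_p = 0) ℱ`, spanned by the Slater determinants with as many momenta
inside the Fermi ball (holes) as outside (particles). -/
def balancedSector (kF : ℝ) : Set Fock :=
  {ξ | ∀ S : Finset Momentum, ξ S ≠ 0 →
    (S.filter (fun p => p ∈ fermiBall kF)).card = (S.filter (fun p => p ∉ fermiBall kF)).card}

end FermiGas

end

open scoped InnerProductSpace

noncomputable section

namespace FermiGas

/-! ### Counting lattice points in cylindrical shells -/

/-- A momentum as a vector of Euclidean space. -/
def toE (p : Momentum) : EuclideanSpace ℝ (Fin 3) := WithLp.toLp 2 (fun i => (p i : ℝ))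

lemma toE_apply (p : Momentum) (i : Fin 3) : toE p i = (p i : ℝ) := rfl

lemma toE_add (p q : Momentum) : toE (p + q) = toE p + toE q := by
  ext i; simp [toE_apply]

lemma toE_sub (p q : Momentum) : toE (p - q) = toE p - toE q := by
  ext i; simp [toE_apply]

lemma toE_smul (m : ℤ) (p : Momentum) : toE (m • p) = (m : ℝ) • toE p := by
  ext i; simp [toE_apply]

lemma norm_toE (p : Momentum) : ‖toE p‖ = len p := by
  rw [EuclideanSpace.norm_eq]
  simp [len, toE_apply]

lemma len_nonneg (p : Momentum) : 0 ≤ len p := Real.sqrt_nonneg _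

/-- The integer `|p|²`. -/
def lenSq (p : Momentum) : ℤ := ∑ i, p i ^ 2

lemma len_sq (p : Momentum) : len p ^ 2 = (lenSq p : ℝ) := by
  rw [len, Real.sq_sqrt (Finset.sum_nonneg fun i _ => sq_nonneg _)]
  simp [lenSq]

lemma lenSq_pos {p : Momentum} (hp : p ≠ 0) : 0 < lenSq p := by
  obtain ⟨i, hi⟩ := Function.ne_iff.1 hp
  refine Finset.sum_pos' (fun j _ => sq_nonneg _) ⟨i, Finset.mem_univ i, ?_⟩
  have : p i ≠ 0 := hi
  positivity

lemma one_le_len {p : Momentum} (hp : p ≠ 0) : 1 ≤ len p := by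
  have h : (1 : ℝ) ≤ len p ^ 2 := by
    rw [len_sq]; exact_mod_cast lenSq_pos hp
  nlinarith [len_nonneg p]

lemma one_le_dist_toE {p q : Momentum} (h : p ≠ q) : 1 ≤ dist (toE p) (toE q) := by
  rw [dist_eq_norm, ← toE_sub, norm_toE]
  exact one_le_len (sub_ne_zero.2 h)

open MeasureTheory

lemma volume_annulus {r₁ r₂ : ℝ} (h0 : 0 ≤ r₁) (h : r₁ ≤ r₂) :
    volume {x : EuclideanSpace ℝ (Fin 2) | r₁ ≤ ‖x‖ ∧ ‖x‖ ≤ r₂} ≤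
      ENNReal.ofReal (Real.pi * (r₂ ^ 2 - r₁ ^ 2)) := by
  have hset : {x : EuclideanSpace ℝ (Fin 2) | r₁ ≤ ‖x‖ ∧ ‖x‖ ≤ r₂} =
      Metric.closedBall 0 r₂ \ Metric.ball 0 r₁ := by
    ext x
    simp [and_comm]
  rw [hset, measure_sdiff (Metric.ball_subset_closedBall.trans (Metric.closedBall_subset_closedBall h))
    measurableSet_ball.nullMeasurableSet measure_ball_lt_top.ne,
    EuclideanSpace.volume_closedBall_fin_two, EuclideanSpace.volume_ball_fin_two]
  rw [← ENNReal.ofReal_pow (h0.trans h), ← ENNReal.ofReal_pow h0]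
  rw [← ENNReal.ofReal_mul (by positivity), ← ENNReal.ofReal_mul (by positivity),
    ← ENNReal.ofReal_sub _ (by positivity)]
  apply le_of_eq
  congr 1
  ring

/-- Splitting off the first coordinate. -/
def splitFirst (x : EuclideanSpace ℝ (Fin 3)) : ℝ × EuclideanSpace ℝ (Fin 2) :=
  (x 0, WithLp.toLp 2 (fun i => x (Fin.succ i)))

lemma measurePreserving_splitFirst : MeasurePreserving splitFirst volume volume := by
  have h1 := PiLp.volume_preserving_ofLp (Fin 3)
  have h2 := volume_preserving_piFinSuccAbove (fun _ : Fin 3 => ℝ) 0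
  have h3 := (MeasurePreserving.id (volume : Measure ℝ)).prod (PiLp.volume_preserving_toLp (Fin 2))
  have h4 := h3.comp (h2.comp h1)
  exact h4

lemma norm_sq_splitFirst (x : EuclideanSpace ℝ (Fin 3)) :
    ‖(splitFirst x).2‖ ^ 2 = ‖x‖ ^ 2 - (splitFirst x).1 ^ 2 := by
  rw [EuclideanSpace.real_norm_sq_eq, EuclideanSpace.real_norm_sq_eq, Fin.sum_univ_three,
    Fin.sum_univ_two]
  simp [splitFirst]
  ring

lemma volume_cylinder (e : EuclideanSpace ℝ (Fin 3)) (he : ‖e‖ = 1) {t₁ t₂ r₁ r₂ : ℝ}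
    (h0 : 0 ≤ r₁) (h : r₁ ≤ r₂) :
    volume {x : EuclideanSpace ℝ (Fin 3) | (t₁ ≤ ⟪e, x⟫_ℝ ∧ ⟪e, x⟫_ℝ ≤ t₂) ∧
        r₁ ^ 2 ≤ ‖x‖ ^ 2 - ⟪e, x⟫_ℝ ^ 2 ∧ ‖x‖ ^ 2 - ⟪e, x⟫_ℝ ^ 2 ≤ r₂ ^ 2} ≤
      ENNReal.ofReal (t₂ - t₁) * ENNReal.ofReal (Real.pi * (r₂ ^ 2 - r₁ ^ 2)) := by
  have hor : Orthonormal ℝ (({0} : Set (Fin 3)).domRestrict (fun _ => e)) := by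
    constructor
    · intro i; exact he
    · intro i j hij
      exact absurd (Subsingleton.elim i j) hij
  obtain ⟨b, hb⟩ := hor.exists_orthonormalBasis_extension_of_card_eq (by simp)
  have hb0 : b 0 = e := hb 0 rfl
  have hφ := measurePreserving_splitFirst.comp b.measurePreserving_repr
  have hset : {x : EuclideanSpace ℝ (Fin 3) | (t₁ ≤ ⟪e, x⟫_ℝ ∧ ⟪e, x⟫_ℝ ≤ t₂) ∧
        r₁ ^ 2 ≤ ‖x‖ ^ 2 - ⟪e, x⟫_ℝ ^ 2 ∧ ‖x‖ ^ 2 - ⟪e, x⟫_ℝ ^ 2 ≤ r₂ ^ 2} =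
      (splitFirst ∘ b.repr) ⁻¹' (Set.Icc t₁ t₂ ×ˢ
        {x : EuclideanSpace ℝ (Fin 2) | r₁ ≤ ‖x‖ ∧ ‖x‖ ≤ r₂}) := by
    ext x
    have hx : (splitFirst (b.repr x)).1 = ⟪e, x⟫_ℝ := by
      simp [splitFirst, b.repr_apply_apply, hb0]
    have hn := norm_sq_splitFirst (b.repr x)
    rw [hx, b.repr.norm_map] at hn
    simp only [Set.mem_ofPred_eq, Set.mem_preimage, Function.comp, Set.mem_prod, Set.mem_Icc, hx,
      ← hn]
    rw [sq_le_sq₀ h0 (norm_nonneg _), sq_le_sq₀ (norm_nonneg _) (h0.trans h)]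
  have hms : MeasurableSet {x : EuclideanSpace ℝ (Fin 2) | r₁ ≤ ‖x‖ ∧ ‖x‖ ≤ r₂} :=
    (measurableSet_le measurable_const measurable_norm).inter
      (measurableSet_le measurable_norm measurable_const)
  rw [hset, hφ.measure_preimage (measurableSet_Icc.prod hms).nullMeasurableSet,
    Measure.volume_eq_prod, Measure.prod_prod, Real.volume_Icc]
  gcongr
  exact volume_annulus h0 h

/-- The distance from `x` to the axis `ℝ e`, squared. -/
lemma perp_sq (e x : EuclideanSpace ℝ (Fin 3)) (he : ‖e‖ = 1) :
    ‖x - ⟪e, x⟫_ℝ • e‖ ^ 2 = ‖x‖ ^ 2 - ⟪e, x⟫_ℝ ^ 2 := by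
  rw [norm_sub_sq_real, inner_smul_right, norm_smul, he, real_inner_comm]
  simp
  ring

lemma perp_norm_le (e x : EuclideanSpace ℝ (Fin 3)) (he : ‖e‖ = 1) :
    ‖x - ⟪e, x⟫_ℝ • e‖ ≤ ‖x‖ := by
  refine le_of_sq_le_sq ?_ (norm_nonneg _)
  rw [perp_sq e x he]
  nlinarith [sq_nonneg ⟪e, x⟫_ℝ]

lemma perp_lipschitz (e x y : EuclideanSpace ℝ (Fin 3)) (he : ‖e‖ = 1) :
    |‖x - ⟪e, x⟫_ℝ • e‖ - ‖y - ⟪e, y⟫_ℝ • e‖| ≤ ‖x - y‖ := by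
  refine (abs_norm_sub_norm_le _ _).trans ?_
  have : x - ⟪e, x⟫_ℝ • e - (y - ⟪e, y⟫_ℝ • e) = (x - y) - ⟪e, x - y⟫_ℝ • e := by
    rw [inner_sub_right, sub_smul]; abel
  rw [this]
  exact perp_norm_le e _ he

/-- The number of lattice points in a cylindrical shell is bounded by its volume, up to boundary
terms. -/
lemma exists_card_shell_le : ∃ C : ℝ, 0 < C ∧ ∀ (e c : EuclideanSpace ℝ (Fin 3)), ‖e‖ = 1 →
    ∀ t a s₁ s₂ r : ℝ, 0 ≤ a → s₁ ≤ s₂ → 0 ≤ r → ∀ F : Finset Momentum,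
    (∀ p ∈ F, (t ≤ ⟪e, toE p - c⟫_ℝ ∧ ⟪e, toE p - c⟫_ℝ ≤ t + a) ∧
      (s₁ ≤ ‖toE p - c‖ ^ 2 - ⟪e, toE p - c⟫_ℝ ^ 2 ∧
        ‖toE p - c‖ ^ 2 - ⟪e, toE p - c⟫_ℝ ^ 2 ≤ s₂) ∧
      ‖toE p - c‖ ^ 2 - ⟪e, toE p - c⟫_ℝ ^ 2 ≤ r ^ 2) →
    (F.card : ℝ) ≤ C * (a + 1) * (s₂ - s₁ + r + 1) := by
  set v := volume (Metric.ball (0 : EuclideanSpace ℝ (Fin 3)) (1 / 2)) with hv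
  have hv0 : v ≠ 0 := (Metric.measure_ball_pos _ _ (by norm_num)).ne'
  have hv1 : v ≠ ⊤ := measure_ball_lt_top.ne
  have hvr : 0 < v.toReal := ENNReal.toReal_pos hv0 hv1
  refine ⟨8 * Real.pi / v.toReal, by positivity, ?_⟩
  intro e c he t a s₁ s₂ r ha hs hr F hF
  rcases F.eq_empty_or_nonempty with rfl | ⟨p₀, hp₀⟩
  · simp only [Finset.card_empty, Nat.cast_zero]
    have : 0 ≤ s₂ - s₁ := sub_nonneg.2 hs
    positivity
  have hperp (p : Momentum) := perp_sq e (toE p - c) he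
  have hnn (p : Momentum) : 0 ≤ ‖toE p - c‖ ^ 2 - ⟪e, toE p - c⟫_ℝ ^ 2 := by
    rw [← hperp p]; positivity
  have hs₂ : 0 ≤ s₂ := (hnn p₀).trans (hF p₀ hp₀).2.1.2
  set ρ₂ := min (√s₂) r with hρ₂
  set ρ₁ := min (√s₁) ρ₂ with hρ₁
  have h2 : 0 ≤ ρ₂ := le_min (Real.sqrt_nonneg _) hr
  have h1 : 0 ≤ ρ₁ := le_min (Real.sqrt_nonneg _) h2
  have h12 : ρ₁ ≤ ρ₂ := min_le_right _ _
  have hdiff : ρ₂ ^ 2 - ρ₁ ^ 2 ≤ s₂ - s₁ := by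
    have hρ : ρ₂ ^ 2 ≤ s₂ := by
      calc ρ₂ ^ 2 ≤ √s₂ ^ 2 := by gcongr; exact min_le_left _ _
        _ = s₂ := Real.sq_sqrt hs₂
    rcases le_total (√s₁) ρ₂ with h | h
    · have : ρ₁ = √s₁ := min_eq_left h
      rw [this]
      have : s₁ ≤ √s₁ ^ 2 := by
        rcases le_total 0 s₁ with h' | h'
        · rw [Real.sq_sqrt h']
        · exact h'.trans (sq_nonneg _)
      linarith
    · have : ρ₁ = ρ₂ := min_eq_right h
      rw [this]; linarith
  have hρ₂r : ρ₂ ≤ r := min_le_right _ _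
  set R₁ := max (ρ₁ - 1) 0 with hR₁
  have hpt (p : Momentum) (hp : p ∈ F) : ρ₁ ≤ ‖(toE p - c) - ⟪e, toE p - c⟫_ℝ • e‖ ∧
      ‖(toE p - c) - ⟪e, toE p - c⟫_ℝ • e‖ ≤ ρ₂ := by
    obtain ⟨-, ⟨h3, h4⟩, h5⟩ := hF p hp
    rw [← hperp p] at h3 h4 h5
    constructor
    · refine (min_le_left _ _).trans ?_
      exact (Real.sqrt_le_sqrt h3).trans (Real.sqrt_sq (norm_nonneg _)).le
    · refine le_min (Real.le_sqrt_of_sq_le h4) (le_of_sq_le_sq h5 hr)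
  set T : Set (EuclideanSpace ℝ (Fin 3)) := {x | (t - 1 ≤ ⟪e, x⟫_ℝ ∧ ⟪e, x⟫_ℝ ≤ t + a + 1) ∧
        R₁ ^ 2 ≤ ‖x‖ ^ 2 - ⟪e, x⟫_ℝ ^ 2 ∧ ‖x‖ ^ 2 - ⟪e, x⟫_ℝ ^ 2 ≤ (ρ₂ + 1) ^ 2} with hT
  have hsub : (⋃ p ∈ F, Metric.ball (toE p - c) (1 / 2)) ⊆ T := by
    intro x hx
    simp only [Set.mem_iUnion, exists_prop, Metric.mem_ball, dist_eq_norm] at hx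
    obtain ⟨p, hp, hx⟩ := hx
    obtain ⟨⟨h3, h4⟩, -, -⟩ := hF p hp
    have h5 : |⟪e, x⟫_ℝ - ⟪e, toE p - c⟫_ℝ| ≤ 1 / 2 := by
      rw [← inner_sub_right]
      refine (abs_real_inner_le_norm _ _).trans ?_
      rw [he, one_mul]; exact hx.le
    have h6 := (perp_lipschitz e x (toE p - c) he).trans hx.le
    obtain ⟨h7, h8⟩ := hpt p hp
    rw [abs_le] at h5 h6
    refine ⟨⟨by linarith, by linarith⟩, ?_⟩
    rw [← perp_sq e x he]
    refine ⟨?_, ?_⟩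
    · have : R₁ ≤ ‖x - ⟪e, x⟫_ℝ • e‖ := max_le (by linarith) (norm_nonneg _)
      gcongr
    · gcongr
      linarith
  have hdisj : (F : Set Momentum).PairwiseDisjoint
      (fun p => Metric.ball (toE p - c) (1 / 2)) := by
    intro p _ q _ hpq
    apply Metric.ball_disjoint_ball
    have := one_le_dist_toE hpq
    rw [dist_sub_right]
    linarith
  have hcount : (F.card : ENNReal) * v ≤ ENNReal.ofReal (2 * (a + 1) * (Real.pi * ((ρ₂ + 1) ^ 2 - R₁ ^ 2))) := by
    calc (F.card : ENNReal) * v = ∑ p ∈ F, volume (Metric.ball (toE p - c) (1 / 2)) := by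
          rw [Finset.sum_congr rfl (fun p _ => Measure.addHaar_ball_center volume (toE p - c) _)]
          simp [hv]
      _ = volume (⋃ p ∈ F, Metric.ball (toE p - c) (1 / 2)) :=
          (measure_biUnion_finset hdisj fun _ _ => measurableSet_ball).symm
      _ ≤ volume T := measure_mono hsub
      _ ≤ ENNReal.ofReal ((t + a + 1) - (t - 1)) *
            ENNReal.ofReal (Real.pi * ((ρ₂ + 1) ^ 2 - R₁ ^ 2)) :=
          volume_cylinder e he (le_max_right _ _) (max_le (by linarith) (by linarith))
      _ ≤ _ := by
          rw [← ENNReal.ofReal_mul (by linarith)]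
          have hnn : 0 ≤ Real.pi * ((ρ₂ + 1) ^ 2 - R₁ ^ 2) := by
            have : R₁ ≤ ρ₂ + 1 := max_le (by linarith) (by linarith)
            have h3 : R₁ ^ 2 ≤ (ρ₂ + 1) ^ 2 := by gcongr
            have := Real.pi_pos
            have h4 : 0 ≤ (ρ₂ + 1) ^ 2 - R₁ ^ 2 := by linarith
            positivity
          apply ENNReal.ofReal_le_ofReal
          refine mul_le_mul_of_nonneg_right ?_ hnn
          linarith
  have hreal : (F.card : ℝ) * v.toReal ≤ 2 * (a + 1) * (Real.pi * ((ρ₂ + 1) ^ 2 - R₁ ^ 2)) := by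
    have h3 : 0 ≤ 2 * (a + 1) * (Real.pi * ((ρ₂ + 1) ^ 2 - R₁ ^ 2)) := by
      have : R₁ ≤ ρ₂ + 1 := max_le (by linarith) (by linarith)
      have h3 : R₁ ^ 2 ≤ (ρ₂ + 1) ^ 2 := by gcongr
      have h4 : 0 ≤ (ρ₂ + 1) ^ 2 - R₁ ^ 2 := by linarith
      have := Real.pi_pos
      positivity
    have h4 := ENNReal.toReal_mono ENNReal.ofReal_ne_top hcount
    rwa [ENNReal.toReal_mul, ENNReal.toReal_natCast, ENNReal.toReal_ofReal h3] at h4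
  have harea : (ρ₂ + 1) ^ 2 - R₁ ^ 2 ≤ 4 * (s₂ - s₁ + r + 1) := by
    rcases le_total ρ₁ 1 with h | h
    · have : R₁ = 0 := max_eq_right (by linarith)
      rw [this]
      nlinarith
    · have : R₁ = ρ₁ - 1 := max_eq_left (by linarith)
      rw [this]
      nlinarith
  rw [div_mul_eq_mul_div, div_mul_eq_mul_div, le_div_iff₀ hvr]
  refine hreal.trans ?_
  have hpi := Real.pi_pos
  calc 2 * (a + 1) * (Real.pi * ((ρ₂ + 1) ^ 2 - R₁ ^ 2))
      ≤ 2 * (a + 1) * (Real.pi * (4 * (s₂ - s₁ + r + 1))) := by gcongr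
    _ = _ := by ring

/-! ### The Fermi ball -/

lemma mem_fermiBall {kF : ℝ} {p : Momentum} : p ∈ fermiBall kF ↔ len p ≤ kF := by
  simp [fermiBall]

lemma mem_lune {kF : ℝ} {k p : Momentum} :
    p ∈ lune kF k ↔ len (p - k) ≤ kF ∧ kF < len p := by
  simp only [lune, Finset.mem_filter, Finset.mem_image, mem_fermiBall, not_le]
  constructor
  · rintro ⟨⟨h, hh, rfl⟩, h2⟩
    exact ⟨by simpa using hh, h2⟩
  · rintro ⟨h1, h2⟩
    exact ⟨⟨p - k, h1, by simp⟩, h2⟩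

lemma one_le_particleNumber {kF : ℝ} (h : 0 < kF) : 1 ≤ particleNumber kF := by
  apply Finset.card_pos.2
  refine ⟨0, mem_fermiBall.2 ?_⟩
  simp [len, h.le]

lemma particleNumber_le {kF : ℝ} (h : 0 < kF) : (particleNumber kF : ℝ) ≤ (2 * kF + 1) ^ 3 := by
  have hsub : fermiBall kF ⊆ Fintype.piFinset (fun _ : Fin 3 => Finset.Icc (-⌊kF⌋) ⌊kF⌋) := by
    intro p hp
    rw [mem_fermiBall] at hp
    rw [Fintype.mem_piFinset]
    intro i
    have h1 : |(p i : ℝ)| ≤ kF := by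
      refine le_trans ?_ hp
      rw [← Real.sqrt_sq_eq_abs]
      exact Real.sqrt_le_sqrt
        (Finset.single_le_sum (f := fun j => (p j : ℝ) ^ 2) (fun j _ => sq_nonneg _)
          (Finset.mem_univ i))
    rw [abs_le] at h1
    rw [Finset.mem_Icc]
    constructor
    · have : -(p i) ≤ ⌊kF⌋ := Int.le_floor.2 (by push_cast; linarith)
      linarith
    · exact Int.le_floor.2 h1.2
  have hc := Finset.card_le_card hsub
  rw [Fintype.card_piFinset] at hc
  simp only [Int.card_Icc, Finset.prod_const, Finset.card_univ, Fintype.card_fin] at hc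
  have hf : 0 ≤ ⌊kF⌋ := Int.floor_nonneg.2 h.le
  have h2 : ((⌊kF⌋ + 1 - -⌊kF⌋).toNat : ℝ) ≤ 2 * kF + 1 := by
    have h3 : (((⌊kF⌋ + 1 - -⌊kF⌋).toNat : ℤ) : ℝ) = ((⌊kF⌋ + 1 - -⌊kF⌋ : ℤ) : ℝ) := by
      rw [Int.toNat_of_nonneg (by linarith)]
    rw [Int.cast_natCast] at h3
    rw [h3]
    push_cast
    linarith [Int.floor_le kF]
  calc (particleNumber kF : ℝ) ≤ ((⌊kF⌋ + 1 - -⌊kF⌋).toNat : ℝ) ^ 3 := by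
        exact_mod_cast hc
    _ ≤ _ := by gcongr

lemma le_particleNumber {kF : ℝ} (h : 0 < kF) : (kF / 2) ^ 3 ≤ (particleNumber kF : ℝ) := by
  set m := ⌊kF / 2⌋₊ with hm
  have hm1 : (m : ℝ) ≤ kF / 2 := Nat.floor_le (by positivity)
  have hm2 : kF / 2 < m + 1 := Nat.lt_floor_add_one _
  have hsub : Fintype.piFinset (fun _ : Fin 3 => Finset.Icc (-(m : ℤ)) m) ⊆ fermiBall kF := by
    intro p hp
    rw [Fintype.mem_piFinset] at hp
    rw [mem_fermiBall, len]
    refine Real.sqrt_le_iff.2 ⟨h.le, ?_⟩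
    have h1 (i : Fin 3) : (p i : ℝ) ^ 2 ≤ (m : ℝ) ^ 2 := by
      have := Finset.mem_Icc.1 (hp i)
      refine sq_le_sq' ?_ ?_
      · exact_mod_cast this.1
      · exact_mod_cast this.2
    rw [Fin.sum_univ_three]
    have h2 : (m : ℝ) ^ 2 ≤ (kF / 2) ^ 2 := by gcongr
    nlinarith [h1 0, h1 1, h1 2]
  have hc := Finset.card_le_card hsub
  rw [Fintype.card_piFinset] at hc
  simp only [Int.card_Icc, Finset.prod_const, Finset.card_univ, Fintype.card_fin] at hc
  have h2 : ((m : ℤ) + 1 - -(m : ℤ)).toNat = 2 * m + 1 := by omega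
  rw [h2] at hc
  calc (kF / 2) ^ 3 ≤ (2 * m + 1 : ℝ) ^ 3 := by
        gcongr
        have : (0 : ℝ) ≤ m := Nat.cast_nonneg _
        linarith
    _ ≤ _ := by exact_mod_cast hc

lemma kF_le {kF : ℝ} (h : 0 < kF) : kF ≤ 2 * (particleNumber kF : ℝ) ^ (1 / 3 : ℝ) := by
  have h1 : kF / 2 = ((kF / 2) ^ 3) ^ (1 / 3 : ℝ) := by
    rw [← Real.rpow_natCast, ← Real.rpow_mul (by positivity)]
    norm_num
  have h2 : ((kF / 2) ^ 3) ^ (1 / 3 : ℝ) ≤ (particleNumber kF : ℝ) ^ (1 / 3 : ℝ) :=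
    Real.rpow_le_rpow (by positivity) (le_particleNumber h) (by norm_num)
  linarith

lemma one_le_rpow_particleNumber {kF : ℝ} (h : 0 < kF) {s : ℝ} (hs : 0 ≤ s) :
    1 ≤ (particleNumber kF : ℝ) ^ s :=
  Real.one_le_rpow (by exact_mod_cast one_le_particleNumber h) hs

lemma kF_add_one_le {kF : ℝ} (h : 0 < kF) :
    kF + 1 ≤ 3 * (particleNumber kF : ℝ) ^ (1 / 3 : ℝ) := by
  have := kF_le h
  have := one_le_rpow_particleNumber h (s := 1 / 3) (by norm_num)
  linarith

/-! ### The energy denominators of the lune -/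

/-- The integer `|p|² - |p - k|²`. -/
def luneGap (k p : Momentum) : ℤ := lenSq p - lenSq (p - k)

lemma luneGap_eq (k p : Momentum) : (luneGap k p : ℝ) = len p ^ 2 - len (p - k) ^ 2 := by
  rw [len_sq, len_sq, luneGap]; push_cast; ring

lemma one_le_luneGap {kF : ℝ} {k p : Momentum} (hp : p ∈ lune kF k) :
    (1 : ℝ) ≤ luneGap k p := by
  have h := mem_lune.1 hp
  have h1 : (0 : ℝ) < luneGap k p := by
    rw [luneGap_eq]
    nlinarith [len_nonneg (p - k), len_nonneg p]
  have h2 : (0 : ℤ) < luneGap k p := by exact_mod_cast h1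
  exact_mod_cast h2

/-- The unit vector in the direction of `k`. -/
def dirVec (k : Momentum) : EuclideanSpace ℝ (Fin 3) := (len k)⁻¹ • toE k

/-- The position of `p` relative to `k / 2`. -/
def centered (k p : Momentum) : EuclideanSpace ℝ (Fin 3) := toE p - (1 / 2 : ℝ) • toE k

lemma norm_dirVec {k : Momentum} (hk : k ≠ 0) : ‖dirVec k‖ = 1 := by
  have := one_le_len hk
  rw [dirVec, norm_smul, norm_toE, norm_inv, Real.norm_of_nonneg (len_nonneg k)]
  field_simp

lemma luneGap_eq_inner (k p : Momentum) :
    (luneGap k p : ℝ) = 2 * ⟪toE p, toE k⟫_ℝ - len k ^ 2 := by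
  rw [luneGap_eq, ← norm_toE (p - k), toE_sub, norm_sub_sq_real, norm_toE, norm_toE]
  ring

lemma inner_dirVec_centered {k : Momentum} (hk : k ≠ 0) (p : Momentum) :
    ⟪dirVec k, centered k p⟫_ℝ = luneGap k p / (2 * len k) := by
  have h1 := one_le_len hk
  rw [luneGap_eq_inner, dirVec, centered, real_inner_smul_left, inner_sub_right,
    inner_smul_right, real_inner_self_eq_norm_sq, norm_toE, real_inner_comm]
  field_simp

lemma norm_centered_sq (k p : Momentum) :
    ‖centered k p‖ ^ 2 = len p ^ 2 - luneGap k p / 2 - len k ^ 2 / 4 := by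
  rw [luneGap_eq_inner, centered, norm_sub_sq_real, norm_smul, inner_smul_right, norm_toE,
    norm_toE, Real.norm_of_nonneg (by norm_num)]
  ring

lemma norm_centered_le {kF : ℝ} {k p : Momentum} (hp : p ∈ lune kF k) :
    ‖centered k p‖ ≤ kF + len k / 2 := by
  have h := mem_lune.1 hp
  have : centered k p = toE (p - k) + (1 / 2 : ℝ) • toE k := by
    rw [centered, toE_sub]
    module
  rw [this]
  refine (norm_add_le _ _).trans ?_
  rw [norm_smul, norm_toE, norm_toE]
  norm_num
  linarith [h.1]

/-- The squared distance of `p` from the line through `k / 2` in the direction of `k`. -/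
def axisDistSq (k p : Momentum) : ℝ := ‖centered k p‖ ^ 2 - ⟪dirVec k, centered k p⟫_ℝ ^ 2

lemma centered_sub_smul {k : Momentum} (hk : k ≠ 0) (m : ℤ) (p : Momentum) :
    centered k (p - m • k) = centered k p - (m * len k) • dirVec k := by
  have := one_le_len hk
  rw [centered, centered, toE_sub, toE_smul, dirVec, smul_smul, mul_assoc,
    mul_inv_cancel₀ (by positivity), mul_one]
  abel

lemma inner_centered_sub_smul {k : Momentum} (hk : k ≠ 0) (m : ℤ) (p : Momentum) :
    ⟪dirVec k, centered k (p - m • k)⟫_ℝ = ⟪dirVec k, centered k p⟫_ℝ - m * len k := by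
  rw [centered_sub_smul hk, inner_sub_right, inner_smul_right, real_inner_self_eq_norm_sq,
    norm_dirVec hk]
  ring

lemma axisDistSq_sub_smul {k : Momentum} (hk : k ≠ 0) (m : ℤ) (p : Momentum) :
    axisDistSq k (p - m • k) = axisDistSq k p := by
  rw [axisDistSq, axisDistSq, inner_centered_sub_smul hk, centered_sub_smul hk, norm_sub_sq_real,
    inner_smul_right, norm_smul, norm_dirVec hk, real_inner_comm, mul_one, Real.norm_eq_abs, sq_abs]
  ring

lemma axisDistSq_mem {kF : ℝ} (h0 : 0 < kF) {k p : Momentum} (hk : k ≠ 0) (hp : p ∈ lune kF k)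
    (hkF : len k ≤ 4 * kF) {t₀ t₁ : ℝ} (ht : 0 ≤ t₀) (h₀ : t₀ ≤ ⟪dirVec k, centered k p⟫_ℝ)
    (h₁ : ⟪dirVec k, centered k p⟫_ℝ ≤ t₁) :
    (kF ^ 2 - len k ^ 2 / 4 - len k * t₁ - t₁ ^ 2 ≤ axisDistSq k p ∧
      axisDistSq k p ≤ kF ^ 2 - len k ^ 2 / 4 + len k * t₁ - t₀ ^ 2) ∧
      axisDistSq k p ≤ (3 * kF) ^ 2 := by
  have hK := one_le_len hk
  have hl := mem_lune.1 hp
  have hgap := luneGap_eq k p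
  have hn := norm_centered_sq k p
  have hnl := norm_centered_le hp
  have ht' := inner_dirVec_centered hk p
  rw [axisDistSq]
  set t := ⟪dirVec k, centered k p⟫_ℝ
  have hlam : (luneGap k p : ℝ) = 2 * len k * t := by
    rw [ht']; field_simp
  have h1 : kF ^ 2 ≤ len p ^ 2 := by nlinarith [hl.2]
  have h2 : len (p - k) ^ 2 ≤ kF ^ 2 := by nlinarith [hl.1, len_nonneg (p - k)]
  have h3 : t ^ 2 ≤ t₁ ^ 2 := by nlinarith
  have h4 : t₀ ^ 2 ≤ t ^ 2 := by nlinarith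
  have h5 : len k * t ≤ len k * t₁ := by nlinarith
  refine ⟨⟨?_, ?_⟩, ?_⟩
  · nlinarith
  · nlinarith
  · have h6 : ‖centered k p‖ ^ 2 ≤ (3 * kF) ^ 2 := by
      have := norm_nonneg (centered k p)
      gcongr
      linarith
    nlinarith [sq_nonneg t]

/-- A line in the direction of `k` meets the lune in at most one point. -/
lemma lune_line_unique {kF : ℝ} {k p q : Momentum} (hk : k ≠ 0) (hp : p ∈ lune kF k)
    (hq : q ∈ lune kF k) {m : ℤ} (h : q = p + m • k) : q = p := by
  have key : ∀ p q : Momentum, p ∈ lune kF k → q ∈ lune kF k → ∀ m : ℤ, q = p + m • k →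
      m ≤ 0 := by
    intro p q hp hq m h
    by_contra! hm
    have hl := mem_lune.1 hp
    have hl' := mem_lune.1 hq
    have hgap := luneGap_eq_inner k p
    have h1 := one_le_luneGap hp
    have hK := one_le_len hk
    have h2 : q - k = p + (m - 1) • k := by rw [h, sub_smul, one_smul]; abel
    have h3 : len (q - k) ^ 2 = len p ^ 2 + 2 * (m - 1) * ⟪toE p, toE k⟫_ℝ
        + (m - 1) ^ 2 * len k ^ 2 := by
      rw [h2, ← norm_toE, toE_add, toE_smul, norm_add_sq_real, inner_smul_right, norm_smul,
        norm_toE, norm_toE, mul_pow, Real.norm_eq_abs, sq_abs]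
      push_cast
      ring
    have hm' : (0 : ℝ) ≤ m - 1 := by
      have : (1 : ℝ) ≤ m := by exact_mod_cast hm
      linarith
    have h4 : 0 ≤ 2 * (m - 1) * ⟪toE p, toE k⟫_ℝ := by
      have : 0 ≤ ⟪toE p, toE k⟫_ℝ := by nlinarith
      positivity
    have h5 : 0 ≤ ((m : ℝ) - 1) ^ 2 * len k ^ 2 := by positivity
    nlinarith [len_nonneg (q - k), len_nonneg p, hl.2, hl'.1]
  have h1 := key p q hp hq m h
  have h2 := key q p hq hp (-m) (by rw [h, neg_smul]; abel)
  have : m = 0 := by omega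
  simpa [this] using h

/-- The part of the lune between two planes orthogonal to `k`. -/
lemma exists_card_lune_window_le : ∃ C : ℝ, 0 < C ∧ ∀ kF : ℝ, 0 < kF → ∀ k : Momentum, k ≠ 0 →
    len k ≤ 4 * kF → ∀ t₀ t₁ : ℝ, 0 ≤ t₀ → t₀ ≤ t₁ → ∀ F : Finset Momentum,
    (∀ p ∈ F, p ∈ lune kF k ∧ t₀ ≤ ⟪dirVec k, centered k p⟫_ℝ ∧
      ⟪dirVec k, centered k p⟫_ℝ ≤ t₁) →
    (F.card : ℝ) ≤ C * (t₁ - t₀ + 1) * (2 * len k * t₁ + t₁ ^ 2 - t₀ ^ 2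
      + 3 * kF + 1) ∧
    (F.card : ℝ) ≤ C * (len k + 1) * (2 * len k * t₁ + t₁ ^ 2 - t₀ ^ 2 + 3 * kF + 1) := by
  obtain ⟨C, hC, hcount⟩ := exists_card_shell_le
  refine ⟨C, hC, ?_⟩
  intro kF h0 k hk hkF t₀ t₁ ht₀ ht F hF
  have hK := one_le_len hk
  have hax (p : Momentum) (hp : p ∈ F) := axisDistSq_mem h0 hk (hF p hp).1 hkF ht₀ (hF p hp).2.1
    (hF p hp).2.2
  have hs : kF ^ 2 - len k ^ 2 / 4 - len k * t₁ - t₁ ^ 2 ≤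
      kF ^ 2 - len k ^ 2 / 4 + len k * t₁ - t₀ ^ 2 := by nlinarith
  constructor
  · have := hcount (dirVec k) ((1 / 2 : ℝ) • toE k) (norm_dirVec hk) t₀ (t₁ - t₀) _ _ (3 * kF)
      (by linarith) hs (by positivity) F
      (fun p hp => ⟨⟨(hF p hp).2.1, by
        have := (hF p hp).2.2
        rw [centered] at this
        linarith⟩, hax p hp⟩)
    refine this.trans (le_of_eq ?_)
    ring
  · set τ : Momentum → Momentum := fun p => p - ⌊⟪dirVec k, centered k p⟫_ℝ / len k⌋ • k with hτ
    have hinj : Set.InjOn τ F := by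
      intro p hp q hq hpq
      simp only [hτ] at hpq
      refine (lune_line_unique hk (hF p hp).1 (hF q hq).1 (m := ⌊⟪dirVec k, centered k q⟫_ℝ / len k⌋ -
        ⌊⟪dirVec k, centered k p⟫_ℝ / len k⌋) ?_).symm
      rw [sub_smul]
      generalize ⌊⟪dirVec k, centered k q⟫_ℝ / len k⌋ • k = y at hpq ⊢
      rw [← sub_eq_zero] at hpq ⊢
      rw [← neg_eq_zero, ← hpq]
      abel
    have := hcount (dirVec k) ((1 / 2 : ℝ) • toE k) (norm_dirVec hk) 0 (len k) _ _ (3 * kF)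
      (by linarith) hs (by positivity) (F.image τ) (by
        intro q hq
        obtain ⟨p, hp, rfl⟩ := Finset.mem_image.1 hq
        have h1 := axisDistSq_sub_smul hk ⌊⟪dirVec k, centered k p⟫_ℝ / len k⌋ p
        have h2 := inner_centered_sub_smul hk ⌊⟪dirVec k, centered k p⟫_ℝ / len k⌋ p
        have h3 := Int.floor_le (⟪dirVec k, centered k p⟫_ℝ / len k)
        have h4 := Int.lt_floor_add_one (⟪dirVec k, centered k p⟫_ℝ / len k)
        rw [le_div_iff₀ (by positivity)] at h3
        rw [div_lt_iff₀ (by positivity)] at h4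
        have h5 := hax p hp
        rw [← h1] at h5
        refine ⟨⟨?_, ?_⟩, h5⟩
        · change 0 ≤ ⟪dirVec k, centered k (p - _)⟫_ℝ
          rw [h2]; linarith
        · change ⟪dirVec k, centered k (p - _)⟫_ℝ ≤ _
          rw [h2]; linarith)
    rw [Finset.card_image_of_injOn hinj] at this
    refine this.trans (le_of_eq ?_)
    ring

lemma sum_inv_sq_le_two (n : ℕ) : ∑ j ∈ Finset.range n, 1 / ((j : ℝ) + 1) ^ 2 ≤ 2 := by
  have h : ∀ n : ℕ, ∑ j ∈ Finset.range (n + 1), 1 / ((j : ℝ) + 1) ^ 2 ≤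
      2 - 1 / ((n : ℝ) + 1) := by
    intro n
    induction n with
    | zero => norm_num
    | succ n ih =>
      rw [Finset.sum_range_succ]
      have : 1 / (((n + 1 : ℕ) : ℝ) + 1) ^ 2 ≤ 1 / ((n : ℝ) + 1) - 1 / (((n + 1 : ℕ) : ℝ) + 1) := by
        push_cast
        rw [div_sub_div _ _ (by positivity) (by positivity), div_le_div_iff₀ (by positivity)
          (by positivity)]
        nlinarith
      linarith
  rcases n with _ | n
  · norm_num
  · refine (h n).trans ?_
    have : 0 ≤ 1 / ((n : ℝ) + 1) := by positivity
    linarith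

/-- The energy denominators of the lune, bounded uniformly in `k`. -/
lemma exists_sum_inv_luneGap_le : ∃ C : ℝ, 0 < C ∧ ∀ kF : ℝ, 0 < kF → ∀ k : Momentum, k ≠ 0 →
    ∑ p ∈ lune kF k, 1 / (luneGap k p : ℝ) ≤ C * (particleNumber kF : ℝ) ^ (1 / 3 : ℝ) := by
  obtain ⟨C, hC, hwin⟩ := exists_card_lune_window_le
  refine ⟨522 * C + 5, by positivity, ?_⟩
  intro kF h0 k hk
  have hK := one_le_len hk
  have hN : (1 : ℝ) ≤ particleNumber kF := by exact_mod_cast one_le_particleNumber h0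
  set ν := (particleNumber kF : ℝ) ^ (1 / 3 : ℝ) with hν
  have hν1 : 1 ≤ ν := one_le_rpow_particleNumber h0 (by norm_num)
  rcases le_or_gt (len k) (4 * kF) with hkF | hkF
  swap
  · have hcard : ((lune kF k).card : ℝ) ≤ ν ^ 3 := by
      have h1 : (lune kF k).card ≤ particleNumber kF :=
        (Finset.card_filter_le _ _).trans Finset.card_image_le
      have h2 : ν ^ 3 = particleNumber kF := by
        rw [hν, ← Real.rpow_natCast, ← Real.rpow_mul (by positivity)]
        norm_num
      rw [h2]
      exact_mod_cast h1
    have hν3 : ν ≤ 3 / 2 * len k := by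
      refine le_of_pow_le_pow_left₀ (n := 3) (by norm_num) (by positivity) ?_
      have h2 : ν ^ 3 = particleNumber kF := by
        rw [hν, ← Real.rpow_natCast, ← Real.rpow_mul (by positivity)]
        norm_num
      rw [h2]
      refine (particleNumber_le h0).trans ?_
      gcongr
      linarith
    have hterm : ∀ p ∈ lune kF k, 1 / (luneGap k p : ℝ) ≤ 2 / len k ^ 2 := by
      intro p hp
      have h1 := one_le_luneGap hp
      rw [div_le_div_iff₀ (by linarith) (by positivity), luneGap_eq]
      have h2 := (mem_lune.1 hp).1
      have h3 : len k ≤ len p + len (p - k) := by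
        have := norm_sub_le (toE p) (toE (p - k))
        rwa [← toE_sub, sub_sub_cancel, norm_toE, norm_toE, norm_toE] at this
      have h4 := len_nonneg (p - k)
      nlinarith
    calc ∑ p ∈ lune kF k, 1 / (luneGap k p : ℝ) ≤ (lune kF k).card • (2 / len k ^ 2) :=
          Finset.sum_le_card_nsmul _ _ _ hterm
      _ = (lune kF k).card * (2 / len k ^ 2) := by rw [nsmul_eq_mul]
      _ ≤ ν ^ 3 * (2 / len k ^ 2) := by gcongr
      _ ≤ 5 * ν := by
          rw [mul_div_assoc', div_le_iff₀ (by positivity)]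
          have : ν ^ 2 ≤ (3 / 2 * len k) ^ 2 := by gcongr
          nlinarith
      _ ≤ _ := by
          gcongr
          linarith
  · set R := kF + 1 with hR
    have hRν : R ≤ 3 * ν := kF_add_one_le h0
    set t : Momentum → ℝ := fun p => ⟪dirVec k, centered k p⟫_ℝ with ht
    have htgap (p : Momentum) : (luneGap k p : ℝ) = 2 * len k * t p := by
      have h1 : t p = _ := inner_dirVec_centered hk p
      rw [h1]; field_simp
    set idx : Momentum → ℕ := fun p => ⌊√(t p)⌋₊ with hidx
    set J := ⌊√(3 * R)⌋₊ with hJ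
    have hJ2 : (J : ℝ) ^ 2 ≤ 3 * R := by
      calc (J : ℝ) ^ 2 ≤ √(3 * R) ^ 2 := by
            gcongr; exact Nat.floor_le (Real.sqrt_nonneg _)
        _ = 3 * R := Real.sq_sqrt (by positivity)
    have htpos : ∀ p ∈ lune kF k, 0 < t p := by
      intro p hp
      have := one_le_luneGap hp
      rw [htgap] at this
      by_contra! h
      nlinarith
    have hmaps : ∀ p ∈ lune kF k, idx p ∈ Finset.range (J + 1) := by
      intro p hp
      rw [Finset.mem_range, Nat.lt_succ_iff]
      apply Nat.floor_le_floor
      apply Real.sqrt_le_sqrt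
      have h1 : t p ≤ ‖dirVec k‖ * ‖centered k p‖ := real_inner_le_norm _ _
      rw [norm_dirVec hk, one_mul] at h1
      have := norm_centered_le hp
      linarith
    rw [← Finset.sum_fiberwise_of_maps_to hmaps]
    have hin : ∀ j : ℕ, ∀ p ∈ (lune kF k).filter (fun p => idx p = j), p ∈ lune kF k ∧
        (j : ℝ) ^ 2 ≤ t p ∧ t p ≤ ((j : ℝ) + 1) ^ 2 := by
      intro j p hp
      obtain ⟨hp', rfl⟩ := Finset.mem_filter.1 hp
      have h1 := htpos p hp'
      have h2 : (idx p : ℝ) ≤ √(t p) := Nat.floor_le (Real.sqrt_nonneg _)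
      have h3 : √(t p) < (idx p : ℝ) + 1 := Nat.lt_floor_add_one _
      have h4 := Real.sq_sqrt h1.le
      refine ⟨hp', ?_, ?_⟩
      · rw [← h4]; gcongr
      · rw [← h4]; gcongr
    have hzero : ∑ p ∈ lune kF k with idx p = 0, 1 / (luneGap k p : ℝ) ≤ 24 * C * R := by
      have h1 := (hwin kF h0 k hk hkF 0 1 le_rfl zero_le_one _ (fun p hp => by
        have := hin 0 p hp
        norm_num at this
        exact this)).1
      calc ∑ p ∈ lune kF k with idx p = 0, 1 / (luneGap k p : ℝ)
          ≤ ((lune kF k).filter (fun p => idx p = 0)).card • (1 : ℝ) := by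
            refine Finset.sum_le_card_nsmul _ _ _ fun p hp => ?_
            have := one_le_luneGap (hin 0 p hp).1
            rw [div_le_one (by linarith)]
            exact this
        _ = ((lune kF k).filter (fun p => idx p = 0)).card := by simp
        _ ≤ _ := h1
        _ ≤ C * (1 - 0 + 1) * (12 * R) := by
            gcongr
            linarith
        _ = _ := by ring
    have hsucc : ∀ j : ℕ, ∑ p ∈ lune kF k with idx p = j + 1, 1 / (luneGap k p : ℝ) ≤
        C * (48 * ((j : ℝ) + 1)) + C * (3 * R * (1 / ((j : ℝ) + 1) ^ 2)) := by
      intro j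
      obtain ⟨h1, h2⟩ := hwin kF h0 k hk hkF (((j : ℝ) + 1) ^ 2) (((j : ℝ) + 2) ^ 2) (by positivity)
        (by gcongr; norm_num) _ (fun p hp => by
        have := hin (j + 1) p hp
        push_cast at this
        rw [add_assoc (j : ℝ), one_add_one_eq_two] at this
        exact this)
      set n := (((lune kF k).filter (fun p => idx p = j + 1)).card : ℝ) with hn
      set x := (j : ℝ) + 1 with hx
      have hx1 : 1 ≤ x := by rw [hx]; linarith [(Nat.cast_nonneg j : (0 : ℝ) ≤ j)]
      have hx2 : (j : ℝ) + 2 = x + 1 := by rw [hx]; ring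
      rw [hx2] at h1 h2
      have e1 : (x + 1) ^ 2 ≤ 4 * x ^ 2 := by nlinarith
      have e2 : ((x + 1) ^ 2) ^ 2 - (x ^ 2) ^ 2 ≤ 32 * x ^ 3 := by
        have : ((x + 1) ^ 2) ^ 2 - (x ^ 2) ^ 2 = 4 * x ^ 3 + 6 * x ^ 2 + 4 * x + 1 := by ring
        rw [this]
        nlinarith [pow_le_pow_right₀ hx1 (show 2 ≤ 3 by norm_num),
          pow_le_pow_right₀ hx1 (show 1 ≤ 3 by norm_num), one_le_pow₀ hx1 (n := 3)]
      have e3 : 2 * len k * (x + 1) ^ 2 ≤ 2 * len k * (4 * x ^ 2) := by gcongr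
      have e4 : (x + 1) ^ 2 - x ^ 2 + 1 ≤ 4 * x := by nlinarith
      have e5 : 2 * len k * (x + 1) ^ 2 + ((x + 1) ^ 2) ^ 2 - (x ^ 2) ^ 2 + 3 * kF + 1 ≤
          2 * len k * (4 * x ^ 2) + 32 * x ^ 3 + 3 * R := by linarith
      have h3 : n ≤ C * (4 * x) * (2 * len k * (4 * x ^ 2) + 32 * x ^ 3 + 3 * R) := by
        refine h1.trans (mul_le_mul (by gcongr) e5 ?_ (by positivity))
        have : 0 ≤ ((x + 1) ^ 2) ^ 2 - (x ^ 2) ^ 2 := sub_nonneg.2 (by gcongr; linarith)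
        have : 0 ≤ 2 * len k * (x + 1) ^ 2 := by positivity
        linarith
      have h4 : n ≤ C * (2 * len k) * (2 * len k * (4 * x ^ 2) + 32 * x ^ 3 + 3 * R) := by
        refine h2.trans (mul_le_mul ?_ e5 ?_ (by positivity))
        · gcongr
          linarith
        have : 0 ≤ ((x + 1) ^ 2) ^ 2 - (x ^ 2) ^ 2 := sub_nonneg.2 (by gcongr; linarith)
        have : 0 ≤ 2 * len k * (x + 1) ^ 2 := by positivity
        linarith
      have h5 : n ≤ C * (4 * x) * (2 * len k * (4 * x ^ 2)) +
          C * (2 * len k) * (32 * x ^ 3 + 3 * R) := by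
        rcases le_total (4 * x) (2 * len k) with h | h
        · refine h3.trans ?_
          have : C * (4 * x) * (32 * x ^ 3 + 3 * R) ≤ C * (2 * len k) * (32 * x ^ 3 + 3 * R) := by
            gcongr
          linarith
        · refine h4.trans ?_
          have : C * (2 * len k) * (2 * len k * (4 * x ^ 2)) ≤
              C * (4 * x) * (2 * len k * (4 * x ^ 2)) := by
            gcongr
          linarith
      calc ∑ p ∈ lune kF k with idx p = j + 1, 1 / (luneGap k p : ℝ)
          ≤ ((lune kF k).filter (fun p => idx p = j + 1)).card • (1 / (2 * len k * x ^ 2)) := by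
            refine Finset.sum_le_card_nsmul _ _ _ fun p hp => ?_
            have := hin (j + 1) p hp
            rw [htgap]
            apply one_div_le_one_div_of_le (by positivity)
            gcongr
            have := this.2.1
            push_cast at this
            exact this
        _ = n * (1 / (2 * len k * x ^ 2)) := by rw [nsmul_eq_mul]
        _ ≤ (C * (4 * x) * (2 * len k * (4 * x ^ 2)) +
          C * (2 * len k) * (32 * x ^ 3 + 3 * R)) * (1 / (2 * len k * x ^ 2)) := by gcongr
        _ = _ := by
            field_simp
            ring
    rw [Finset.sum_range_succ']
    have hsum1 : ∑ j ∈ Finset.range J, ((j : ℝ) + 1) ≤ 3 * R := by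
      refine le_trans ?_ hJ2
      calc ∑ j ∈ Finset.range J, ((j : ℝ) + 1) ≤ ∑ j ∈ Finset.range J, (J : ℝ) := by
            refine Finset.sum_le_sum fun j hj => ?_
            have := Finset.mem_range.1 hj
            exact_mod_cast this
        _ = (J : ℝ) ^ 2 := by simp [sq]
    calc _ ≤ ∑ j ∈ Finset.range J, (C * (48 * ((j : ℝ) + 1)) +
            C * (3 * R * (1 / ((j : ℝ) + 1) ^ 2))) + 24 * C * R :=
          add_le_add (Finset.sum_le_sum fun j _ => hsucc j) hzero
      _ = 48 * C * ∑ j ∈ Finset.range J, ((j : ℝ) + 1) +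
            3 * C * R * ∑ j ∈ Finset.range J, 1 / ((j : ℝ) + 1) ^ 2 + 24 * C * R := by
          rw [Finset.sum_add_distrib, Finset.mul_sum, Finset.mul_sum]
          congr 2
          · exact Finset.sum_congr rfl fun j _ => by ring
          · exact Finset.sum_congr rfl fun j _ => by ring
      _ ≤ 48 * C * (3 * R) + 3 * C * R * 2 + 24 * C * R := by
          gcongr
          exact sum_inv_sq_le_two J
      _ = 174 * C * R := by ring
      _ ≤ 174 * C * (3 * ν) := by gcongr
      _ ≤ _ := by nlinarith

/-! ### The pair operators and the kinetic energy -/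

lemma norm_annihilate_le (p : Momentum) (ξ : Fock) : ‖annihilate p ξ‖ ≤ ‖ξ‖ := by
  refine le_of_sq_le_sq ?_ (norm_nonneg _)
  rw [norm_sq_fock, norm_sq_fock]
  exact tsum_annihilateFun_le p ξ

lemma norm_annihilate_annihilate_comm (p q : Momentum) (ξ : Fock) :
    ‖annihilate p (annihilate q ξ)‖ = ‖annihilate q (annihilate p ξ)‖ := by
  rw [eq_neg_of_add_eq_zero_left (annihilate_annihilate p q ξ), norm_neg]

lemma excitationEnergy_nonneg (kF : ℝ) (p : Momentum) : 0 ≤ excitationEnergy kF p := abs_nonneg _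

lemma kineticForm_nonneg (kF : ℝ) (ξ : Fock) : 0 ≤ kineticForm kF ξ :=
  tsum_nonneg fun p => mul_nonneg (excitationEnergy_nonneg kF p) (sq_nonneg _)

lemma excitationEnergy_eq {kF : ℝ} (p : Momentum) :
    excitationEnergy kF p = hbar kF ^ 2 * |len p ^ 2 - kF ^ 2| := by
  have h : kappa kF = hbar kF * kF := by
    rw [kappa, hbar, Real.rpow_neg (by positivity)]
    field_simp
  rw [excitationEnergy, h, mul_pow, ← mul_sub, abs_mul, abs_of_nonneg (sq_nonneg (hbar kF))]

lemma excitationEnergy_add {kF : ℝ} {k p : Momentum} (hp : p ∈ lune kF k) :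
    excitationEnergy kF p + excitationEnergy kF (p - k) = hbar kF ^ 2 * luneGap k p := by
  have h := mem_lune.1 hp
  have h1 := len_nonneg (p - k)
  rw [excitationEnergy_eq, excitationEnergy_eq, luneGap_eq, abs_of_nonneg (by nlinarith),
    abs_of_nonpos (by nlinarith)]
  ring

lemma hbar_sq {kF : ℝ} (h0 : 0 < kF) :
    hbar kF ^ 2 * (particleNumber kF : ℝ) = (particleNumber kF : ℝ) ^ (1 / 3 : ℝ) := by
  have hN : (0 : ℝ) < particleNumber kF := by exact_mod_cast one_le_particleNumber h0
  rw [hbar, ← Real.rpow_natCast, ← Real.rpow_mul hN.le]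
  nth_rewrite 2 [← Real.rpow_one (particleNumber kF : ℝ)]
  rw [← Real.rpow_add hN]
  norm_num

lemma hbar_pos {kF : ℝ} (h0 : 0 < kF) : 0 < hbar kF := by
  have hN : (0 : ℝ) < particleNumber kF := by exact_mod_cast one_le_particleNumber h0
  exact Real.rpow_pos_of_pos hN _

lemma pairOp_zero {kF : ℝ} : pairOp kF 0 = 0 := by
  have : lune kF 0 = ∅ := by
    rw [Finset.eq_empty_iff_forall_notMem]
    intro p hp
    have := mem_lune.1 hp
    rw [sub_zero] at this
    linarith [this.1, this.2]
  simp [pairOp, this]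

/-- The pair operators are controlled by the kinetic energy. -/
lemma exists_norm_pairOp_sq_le : ∃ C : ℝ, 0 < C ∧ ∀ kF : ℝ, 0 < kF → ∀ k : Momentum, ∀ ξ : Fock,
    ξ ∈ kineticDomain kF →
    ‖pairOp kF k ξ‖ ^ 2 ≤ C * (particleNumber kF : ℝ) * kineticForm kF ξ := by
  obtain ⟨C, hC, hS⟩ := exists_sum_inv_luneGap_le
  refine ⟨2 * C, by positivity, ?_⟩
  intro kF h0 k ξ hξ
  have hN : (0 : ℝ) < particleNumber kF := by exact_mod_cast one_le_particleNumber h0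
  have hK := kineticForm_nonneg kF ξ
  have hh := hbar_pos h0
  rcases eq_or_ne k 0 with rfl | hk
  · rw [pairOp_zero]
    simp only [_root_.zero_apply, norm_zero, ne_eq, OfNat.ofNat_ne_zero, not_false_eq_true, zero_pow]
    positivity
  set f : Momentum → ℝ := fun p => excitationEnergy kF p * ‖annihilate p ξ‖ ^ 2 with hf
  have hf0 (p : Momentum) : 0 ≤ f p := mul_nonneg (excitationEnergy_nonneg kF p) (sq_nonneg _)
  have hfs : Summable f := hξ
  set v : Momentum → Fock := fun p => annihilate (p - k) (annihilate p ξ) with hv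
  set w : Momentum → ℝ := fun p => hbar kF ^ 2 * luneGap k p with hw
  have hw0 : ∀ p ∈ lune kF k, 0 < w p := fun p hp => by
    have := one_le_luneGap hp
    have : (0 : ℝ) < luneGap k p := by linarith
    simp only [hw]
    positivity
  have h1 : ‖pairOp kF k ξ‖ ≤ ∑ p ∈ lune kF k, ‖v p‖ := by
    have : pairOp kF k ξ = ∑ p ∈ lune kF k, v p := by simp [pairOp, hv]
    rw [this]
    exact norm_sum_le _ _
  have h2 : (∑ p ∈ lune kF k, ‖v p‖) ^ 2 ≤
      (∑ p ∈ lune kF k, 1 / w p) * ∑ p ∈ lune kF k, w p * ‖v p‖ ^ 2 := by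
    refine Finset.sum_sq_le_sum_mul_sum_of_sq_le_mul _ (fun p hp => ?_) (fun p hp => ?_)
      (fun p hp => ?_)
    · exact (one_div_pos.2 (hw0 p hp)).le
    · exact mul_nonneg (hw0 p hp).le (sq_nonneg _)
    · have := (hw0 p hp).ne'
      apply le_of_eq
      field_simp
  have h3 : ∑ p ∈ lune kF k, 1 / w p ≤ C * (particleNumber kF : ℝ) := by
    have : ∑ p ∈ lune kF k, 1 / w p = 1 / hbar kF ^ 2 * ∑ p ∈ lune kF k, 1 / (luneGap k p : ℝ) := by
      rw [Finset.mul_sum]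
      refine Finset.sum_congr rfl fun p hp => ?_
      simp only [hw]
      rw [one_div_mul_one_div]
    rw [this, one_div_mul_eq_div, div_le_iff₀ (by positivity)]
    refine (hS kF h0 k hk).trans (le_of_eq ?_)
    rw [← hbar_sq h0]
    ring
  have h4 : ∑ p ∈ lune kF k, w p * ‖v p‖ ^ 2 ≤ 2 * kineticForm kF ξ := by
    calc ∑ p ∈ lune kF k, w p * ‖v p‖ ^ 2 ≤ ∑ p ∈ lune kF k, (f p + f (p - k)) := by
          refine Finset.sum_le_sum fun p hp => ?_
          have e1 : ‖v p‖ ≤ ‖annihilate p ξ‖ := norm_annihilate_le _ _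
          have e2 : ‖v p‖ ≤ ‖annihilate (p - k) ξ‖ := by
            rw [hv]
            simp only
            rw [norm_annihilate_annihilate_comm]
            exact norm_annihilate_le _ _
          simp only [hw, hf]
          rw [← excitationEnergy_add hp, add_mul]
          have := excitationEnergy_nonneg kF p
          have := excitationEnergy_nonneg kF (p - k)
          gcongr
      _ = ∑ p ∈ lune kF k, f p + ∑ p ∈ (lune kF k).image (fun p => p - k), f p := by
          rw [Finset.sum_add_distrib, Finset.sum_image]
          intro p _ q _ h
          exact sub_left_injective h
      _ ≤ kineticForm kF ξ + kineticForm kF ξ := by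
          gcongr
          · exact hfs.sum_le_tsum _ fun p _ => hf0 p
          · exact hfs.sum_le_tsum _ fun p _ => hf0 p
      _ = _ := by ring
  calc ‖pairOp kF k ξ‖ ^ 2 ≤ (∑ p ∈ lune kF k, ‖v p‖) ^ 2 := by gcongr
    _ ≤ _ := h2
    _ ≤ C * (particleNumber kF : ℝ) * (2 * kineticForm kF ξ) := by
        refine mul_le_mul h3 h4 ?_ (by positivity)
        exact Finset.sum_nonneg fun p hp => mul_nonneg (hw0 p hp).le (sq_nonneg _)
    _ = _ := by ring

/-- The coupling term is bounded by the non-bosonizable term and the kinetic energy. -/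
lemma exists_E2Form_le (V : Momentum → ℝ) (hV : Summable V) (hV0 : ∀ k, 0 ≤ V k) :
    ∃ C : ℝ, 0 < C ∧ ∀ kF : ℝ, 0 < kF → ∀ α : ℝ,
      ∀ ξ : Fock, ξ ∈ E1Domain V kF → ξ ∈ kineticDomain kF →
        Summable (fun k => V k * couplingForm kF k ξ) ∧
        |E2Form V kF ξ| ≤ (particleNumber kF : ℝ) ^ α * E1Form V kF ξ
          + C * (particleNumber kF : ℝ) ^ (-α) * kineticForm kF ξ := by
  obtain ⟨C, hC, hb⟩ := exists_norm_pairOp_sq_le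
  have hVs : 0 ≤ ∑' k, V k := tsum_nonneg hV0
  refine ⟨C / 2 * (∑' k, V k) + 1, by positivity, ?_⟩
  intro kF h0 α ξ h1 hkin
  have hN : (0 : ℝ) < particleNumber kF := by exact_mod_cast one_le_particleNumber h0
  have hK := kineticForm_nonneg kF ξ
  set N := (particleNumber kF : ℝ) with hNdef
  have hNα : 0 < N ^ α := Real.rpow_pos_of_pos hN _
  have hNα' : N ^ (-α) = (N ^ α)⁻¹ := Real.rpow_neg hN.le _
  set D : ℝ := C * N * kineticForm kF ξ with hD
  set g : Momentum → ℝ := fun k =>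
    N ^ α * (V k * ‖nonBosonizable kF k ξ‖ ^ 2) + N ^ (-α) * D * V k with hg
  have hgs : Summable g := (h1.2.mul_left _).add (hV.mul_left _)
  have hle (k : Momentum) : ‖V k * couplingForm kF k ξ‖ ≤ g k := by
    rw [norm_mul, Real.norm_of_nonneg (hV0 k), Real.norm_eq_abs]
    have e1 : |couplingForm kF k ξ| ≤ 2 * (‖nonBosonizable kF k ξ‖ * ‖pairOp kF (-k) ξ‖) := by
      rw [couplingForm, abs_mul, abs_two]
      gcongr
      exact (Complex.abs_re_le_norm _).trans (norm_inner_le_norm _ _)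
    have e2 := hb kF h0 (-k) ξ hkin
    have e3 : 2 * (‖nonBosonizable kF k ξ‖ * ‖pairOp kF (-k) ξ‖) ≤
        N ^ α * ‖nonBosonizable kF k ξ‖ ^ 2 + N ^ (-α) * ‖pairOp kF (-k) ξ‖ ^ 2 := by
      set x := ‖nonBosonizable kF k ξ‖
      set y := ‖pairOp kF (-k) ξ‖
      have : N ^ α * x ^ 2 + N ^ (-α) * y ^ 2 - 2 * (x * y) = N ^ α * (x - N ^ (-α) * y) ^ 2 := by
        rw [hNα']; field_simp; ring
      nlinarith [mul_nonneg hNα.le (sq_nonneg (x - N ^ (-α) * y))]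
    have e4 : N ^ (-α) * ‖pairOp kF (-k) ξ‖ ^ 2 ≤ N ^ (-α) * D := by
      gcongr
    calc V k * |couplingForm kF k ξ| ≤
          V k * (N ^ α * ‖nonBosonizable kF k ξ‖ ^ 2 + N ^ (-α) * D) := by
          have := hV0 k
          gcongr
          linarith
      _ = g k := by simp only [hg]; ring
  have hsum : Summable (fun k => V k * couplingForm kF k ξ) := Summable.of_norm_bounded hgs hle
  refine ⟨hsum, ?_⟩
  rw [E2Form, abs_mul, abs_of_nonneg (by positivity)]
  have h2 : |∑' k, V k * couplingForm kF k ξ| ≤ ∑' k, g k :=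
    tsum_of_norm_bounded hgs.hasSum hle
  have h3 : ∑' k, g k = N ^ α * (∑' k, V k * ‖nonBosonizable kF k ξ‖ ^ 2) +
      N ^ (-α) * D * ∑' k, V k := by
    rw [(h1.2.mul_left _).tsum_add (hV.mul_left _), tsum_mul_left, tsum_mul_left]
  rw [h3] at h2
  calc _ ≤ 1 / (2 * N) * (N ^ α * (∑' k, V k * ‖nonBosonizable kF k ξ‖ ^ 2) +
      N ^ (-α) * D * ∑' k, V k) := by gcongr
    _ = N ^ α * E1Form V kF ξ + (C / 2 * ∑' k, V k) * N ^ (-α) * kineticForm kF ξ := by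
        rw [E1Form, ← hNdef, hD]
        field_simp
    _ ≤ _ := by
        gcongr
        linarith

/-! ### Representations of integers by binary quadratic forms -/

/-- The binary quadratic form `a x² + b x y + c y²`. -/
def binForm (a b c : ℤ) (v : ℤ × ℤ) : ℤ := a * v.1 ^ 2 + b * v.1 * v.2 + c * v.2 ^ 2

lemma binForm_swap (a b c : ℤ) (v : ℤ × ℤ) : binForm c b a v.swap = binForm a b c v := by
  simp only [binForm, Prod.fst_swap, Prod.snd_swap]; ring

lemma four_mul_binForm (a b c : ℤ) (v : ℤ × ℤ) :
    4 * a * binForm a b c v = (2 * a * v.1 + b * v.2) ^ 2 + (4 * a * c - b ^ 2) * v.2 ^ 2 := by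
  simp only [binForm]; ring

lemma binForm_nonneg {a b c : ℤ} (ha : 0 < a) (hd : b ^ 2 < 4 * a * c) (v : ℤ × ℤ) :
    0 ≤ binForm a b c v := by
  have h := four_mul_binForm a b c v
  have h1 : 0 ≤ 4 * a * binForm a b c v := by
    rw [h]
    have : 0 ≤ 4 * a * c - b ^ 2 := by linarith
    positivity
  exact nonneg_of_mul_nonneg_right h1 (by positivity)

lemma binForm_eq_zero {a b c : ℤ} (ha : 0 < a) (hd : b ^ 2 < 4 * a * c) {v : ℤ × ℤ}
    (h0 : binForm a b c v = 0) : v = 0 := by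
  have h := four_mul_binForm a b c v
  rw [h0, mul_zero] at h
  have hd' : 0 < 4 * a * c - b ^ 2 := by linarith
  have h1 : 0 ≤ (4 * a * c - b ^ 2) * v.2 ^ 2 := by positivity
  have h2 : (4 * a * c - b ^ 2) * v.2 ^ 2 = 0 := by nlinarith [sq_nonneg (2 * a * v.1 + b * v.2)]
  have h3 : v.2 = 0 := by
    rcases mul_eq_zero.1 h2 with h | h
    · omega
    · exact pow_eq_zero_iff (two_ne_zero) |>.1 h
  rw [h3] at h
  have h4 : (2 * a * v.1) ^ 2 = 0 := by linarith
  have h5 : v.1 = 0 := by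
    have := pow_eq_zero_iff (two_ne_zero) |>.1 h4
    rcases mul_eq_zero.1 this with h | h
    · omega
    · exact h
  exact Prod.ext h5 h3

lemma coeff_pos_of_posDef {a b c : ℤ} (ha : 0 < a) (hd : b ^ 2 < 4 * a * c) : 0 < c := by
  by_contra! h
  nlinarith [sq_nonneg b, mul_nonneg ha.le (neg_nonneg.2 h)]

/-- No positive definite binary form represents `M` more than `B` times. -/
def RepBound (B : ℝ) (M : ℤ) : Prop :=
  ∀ a b c : ℤ, 0 < a → b ^ 2 < 4 * a * c → ∀ F : Finset (ℤ × ℤ),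
    (∀ v ∈ F, binForm a b c v = M) → (F.card : ℝ) ≤ B

lemma RepBound.nonneg {B : ℝ} {M : ℤ} (h : RepBound B M) : 0 ≤ B := by
  simpa using h 1 0 1 one_pos (by norm_num) ∅ (by simp)

lemma repBound_one : RepBound 8 1 := by
  intro a b c ha hd F hF
  classical
  set φ : ℤ × ℤ → ZMod 2 × ZMod 2 := fun v => ((v.1 : ZMod 2), (v.2 : ZMod 2)) with hφ
  have hfib : ∀ x ∈ F.image φ, (F.filter (fun v => φ v = x)).card ≤ 2 := by
    intro x hx
    obtain ⟨v, hv, rfl⟩ := Finset.mem_image.1 hx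
    refine (Finset.card_le_card (t := {v, -v}) ?_).trans Finset.card_le_two
    intro w hw
    obtain ⟨hw, hwv⟩ := Finset.mem_filter.1 hw
    simp only [hφ, Prod.mk.injEq] at hwv
    obtain ⟨s, hs⟩ := (ZMod.intCast_eq_intCast_iff_dvd_sub _ _ 2).1 hwv.1.symm
    obtain ⟨t, ht⟩ := (ZMod.intCast_eq_intCast_iff_dvd_sub _ _ 2).1 hwv.2.symm
    push_cast at hs ht
    have h1 : binForm a b c (s, t) + binForm a b c (v.1 + s, v.2 + t) = 1 := by
      have e1 := hF v hv
      have e2 := hF w hw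
      have f1 : w.1 = v.1 + 2 * s := by linarith
      have f2 : w.2 = v.2 + 2 * t := by linarith
      simp only [binForm] at e1 e2 ⊢
      rw [f1, f2] at e2
      linarith
    have h2 := binForm_nonneg ha hd (s, t)
    have h3 := binForm_nonneg ha hd (v.1 + s, v.2 + t)
    rw [Finset.mem_insert, Finset.mem_singleton]
    have h4 : binForm a b c (s, t) = 0 ∨ binForm a b c (v.1 + s, v.2 + t) = 0 := by omega
    rcases h4 with h | h
    · have := binForm_eq_zero ha hd h
      simp only [Prod.mk_eq_zero] at this
      left
      ext <;> omega
    · have := binForm_eq_zero ha hd h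
      simp only [Prod.mk_eq_zero] at this
      right
      ext
      · simp only [Prod.fst_neg]; omega
      · simp only [Prod.snd_neg]; omega
  have h1 := Finset.card_le_mul_card_image F 2 hfib
  have h2 : (F.image φ).card ≤ 4 := by
    refine (Finset.card_le_univ _).trans ?_
    simp
  have : F.card ≤ 8 := by omega
  exact_mod_cast this

lemma exists_lift_slope {p a b : ℤ} (hp : Prime p) (hb : ¬ p ∣ b) : ∃ t s, b * t + a = p * s := by
  have hco : IsCoprime p b := (hp.irreducible.coprime_iff_not_dvd).2 hb
  obtain ⟨u, w, h⟩ := hco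
  refine ⟨-a * w, a * u, ?_⟩
  linear_combination (-a) * h

/-- A form that splits modulo `p`, restricted to the vectors over one of its two lines. -/
lemma card_le_of_split {p : ℤ} (hp : Prime p) (hpos : 0 < p) {B : ℝ} {M : ℤ} (hB : RepBound B M) (n : ℕ) :
    ∀ a b c : ℤ, 0 < a → b ^ 2 < 4 * a * c → p ∣ c → ¬ p ∣ b → ∀ F : Finset (ℤ × ℤ),
      (∀ v ∈ F, binForm a b c v = p ^ n * M ∧ ¬ p ∣ v.1) → (F.card : ℝ) ≤ B := by
  induction n with
  | zero =>
    intro a b c ha hd _ _ F hF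
    exact hB a b c ha hd F fun v hv => by simpa using (hF v hv).1
  | succ n ih =>
    intro a b c ha hd hc hb F hF
    have hp0 : p ≠ 0 := hp.ne_zero
    obtain ⟨t, s, hts⟩ := exists_lift_slope (a := a) hp hb
    obtain ⟨c', rfl⟩ := hc
    have hdvd : ∀ v ∈ F, p ∣ v.2 - t * v.1 := by
      intro v hv
      obtain ⟨h1, h2⟩ := hF v hv
      have h3 : p ∣ v.1 * (a * v.1 + b * v.2) := by
        refine ⟨p ^ n * M - c' * v.2 ^ 2, ?_⟩
        simp only [binForm] at h1
        linear_combination h1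
      have h4 := (hp.dvd_or_dvd h3).resolve_left h2
      have h5 : p ∣ b * (v.2 - t * v.1) := by
        have : b * (v.2 - t * v.1) = (a * v.1 + b * v.2) - p * (s * v.1) := by
          linear_combination (-v.1) * hts
        rw [this]
        exact dvd_sub h4 (dvd_mul_right _ _)
      exact (hp.dvd_or_dvd h5).resolve_left hb
    set φ : ℤ × ℤ → ℤ × ℤ := fun v => (v.1, (v.2 - t * v.1) / p) with hφ
    have hφ2 : ∀ v ∈ F, v.2 = t * v.1 + p * (φ v).2 := by
      intro v hv
      have := Int.mul_ediv_cancel' (hdvd v hv)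
      simp only [hφ]
      linarith
    have hinj : Set.InjOn φ F := by
      intro v hv w hw h
      have h1 : v.1 = w.1 := (Prod.ext_iff.1 h).1
      have h2 := hφ2 v hv
      rw [h, h1, ← hφ2 w hw] at h2
      exact Prod.ext h1 h2
    rw [← Finset.card_image_of_injOn hinj]
    have hform : p * (s + c' * t ^ 2) = binForm a b (p * c') (1, t) := by
      simp only [binForm]
      linear_combination (-1 : ℤ) * hts
    refine ih (s + c' * t ^ 2) (b + 2 * (p * c') * t) (p * (p * c')) ?_ ?_ (dvd_mul_right _ _) ?_ _ ?_
    · have h1 : binForm a b (p * c') (1, t) ≠ 0 := by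
        intro h
        have := binForm_eq_zero ha hd h
        simp at this
      have h2 := binForm_nonneg ha hd (1, t)
      have h3 : 0 < p * (s + c' * t ^ 2) := by omega
      exact pos_of_mul_pos_right h3 hpos.le
    · have : (b + 2 * (p * c') * t) ^ 2 - 4 * (s + c' * t ^ 2) * (p * (p * c')) =
          b ^ 2 - 4 * a * (p * c') := by
        linear_combination (4 * p * c') * hts
      linarith
    · intro h
      apply hb
      have h2 : b = (b + 2 * (p * c') * t) - p * (2 * c' * t) := by ring
      rw [h2]
      exact dvd_sub h (dvd_mul_right _ _)
    · intro w hw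
      obtain ⟨v, hv, rfl⟩ := Finset.mem_image.1 hw
      obtain ⟨h1, h2⟩ := hF v hv
      refine ⟨?_, h2⟩
      have h3 := hφ2 v hv
      have h4 : (φ v).1 = v.1 := rfl
      apply mul_left_cancel₀ hp0
      simp only [binForm] at h1 ⊢
      rw [h4]
      rw [h3] at h1
      linear_combination h1 - v.1 ^ 2 * hts

/-- The vectors not divisible by `p` that represent `p ^ n * M`. -/
lemma card_primitive_le {p : ℤ} (hp : Prime p) (hpos : 0 < p) {B : ℝ} {M : ℤ} (hB : RepBound B M)
    (n : ℕ) : ∀ a b c : ℤ, 0 < a → b ^ 2 < 4 * a * c → ∀ F : Finset (ℤ × ℤ),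
      (∀ v ∈ F, binForm a b c v = p ^ n * M ∧ ¬ (p ∣ v.1 ∧ p ∣ v.2)) → (F.card : ℝ) ≤ 2 * B := by
  have hB0 := hB.nonneg
  have hp0 : p ≠ 0 := hp.ne_zero
  induction n with
  | zero =>
    intro a b c ha hd F hF
    have := hB a b c ha hd F fun v hv => by simpa using (hF v hv).1
    linarith
  | succ n ih =>
    have aux : ∀ a b c : ℤ, 0 < a → b ^ 2 < 4 * a * c → p ∣ a → ∀ F : Finset (ℤ × ℤ),
        (∀ v ∈ F, binForm a b c v = p ^ (n + 1) * M ∧ ¬ (p ∣ v.1 ∧ p ∣ v.2)) →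
          (F.card : ℝ) ≤ 2 * B := by
      intro a b c ha hd hpa F hF
      obtain ⟨a', rfl⟩ := hpa
      have ha' : 0 < a' := pos_of_mul_pos_right ha hpos.le
      have hinj : ∀ G : Finset (ℤ × ℤ), (∀ v ∈ G, p ∣ v.2) →
          Set.InjOn (fun v : ℤ × ℤ => (v.1, v.2 / p)) G := by
        intro G hG v hv w hw h
        simp only [Prod.mk.injEq] at h
        have h1 := Int.mul_ediv_cancel' (hG v hv)
        have h2 := Int.mul_ediv_cancel' (hG w hw)
        rw [h.2, h2] at h1
        exact Prod.ext h.1 h1.symm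
      have hform : ∀ v : ℤ × ℤ, p ∣ v.2 → binForm (p * a') b c v = p ^ (n + 1) * M →
          binForm a' b (p * c) (v.1, v.2 / p) = p ^ n * M := by
        intro v hv h
        obtain ⟨y, hy⟩ := hv
        have hy' : v.2 / p = y := by rw [hy]; exact Int.mul_ediv_cancel_left _ hp0
        rw [hy']
        simp only [binForm] at h ⊢
        rw [hy] at h
        apply mul_left_cancel₀ hp0
        linear_combination h
      by_cases hb : p ∣ b
      · obtain ⟨b', rfl⟩ := hb
        by_cases hc : p ∣ c
        · obtain ⟨c', rfl⟩ := hc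
          refine ih a' b' c' ha' ?_ F fun v hv => ⟨?_, (hF v hv).2⟩
          · have h1 : p ^ 2 * (4 * a' * c' - b' ^ 2) > 0 := by nlinarith
            have := pos_of_mul_pos_right h1 (sq_nonneg p)
            linarith
          · have := (hF v hv).1
            simp only [binForm] at this ⊢
            apply mul_left_cancel₀ hp0
            linear_combination this
        · have hdv : ∀ v ∈ F, p ∣ v.2 := by
            intro v hv
            have h1 := (hF v hv).1
            have h2 : p ∣ c * v.2 ^ 2 := by
              refine ⟨p ^ n * M - a' * v.1 ^ 2 - b' * v.1 * v.2, ?_⟩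
              simp only [binForm] at h1
              linear_combination h1
            exact hp.dvd_of_dvd_pow ((hp.dvd_or_dvd h2).resolve_left hc)
          rw [← Finset.card_image_of_injOn (hinj F hdv)]
          refine ih a' (p * b') (p * c) ha' (by linarith) _ fun w hw => ?_
          obtain ⟨v, hv, rfl⟩ := Finset.mem_image.1 hw
          exact ⟨hform v (hdv v hv) (hF v hv).1, fun h => (hF v hv).2 ⟨h.1, hdv v hv⟩⟩
      · have h1 : ((F.filter (fun v => p ∣ v.2)).card : ℝ) ≤ B := by
          have hdv : ∀ v ∈ F.filter (fun v => p ∣ v.2), p ∣ v.2 :=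
            fun v hv => (Finset.mem_filter.1 hv).2
          rw [← Finset.card_image_of_injOn (hinj _ hdv)]
          refine card_le_of_split hp hpos hB n a' b (p * c) ha' (by linarith) (dvd_mul_right _ _) hb _
            fun w hw => ?_
          obtain ⟨v, hv, rfl⟩ := Finset.mem_image.1 hw
          have hvF := hF v (Finset.mem_filter.1 hv).1
          exact ⟨hform v (hdv v hv) hvF.1, fun h => hvF.2 ⟨h, hdv v hv⟩⟩
        have h2 : ((F.filter (fun v => ¬ p ∣ v.2)).card : ℝ) ≤ B := by
          rw [← Finset.card_image_of_injective _ Prod.swap_injective]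
          refine card_le_of_split hp hpos hB (n + 1) c b (p * a') (coeff_pos_of_posDef ha hd)
            (by linarith) (dvd_mul_right _ _) hb _ fun w hw => ?_
          obtain ⟨v, hv, rfl⟩ := Finset.mem_image.1 hw
          obtain ⟨hv1, hv2⟩ := Finset.mem_filter.1 hv
          exact ⟨(binForm_swap _ _ _ v).trans (hF v hv1).1, hv2⟩
        have h3 := Finset.card_filter_add_card_filter_not (s := F) (fun v => p ∣ v.2)
        have h4 : (F.card : ℝ) = ((F.filter (fun v => p ∣ v.2)).card : ℝ) +
            ((F.filter (fun v => ¬ p ∣ v.2)).card : ℝ) := by exact_mod_cast h3.symm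
        linarith
    intro a b c ha hd F hF
    rcases F.eq_empty_or_nonempty with rfl | ⟨v₀, hv₀⟩
    · simpa using hB0
    obtain ⟨h1, h2⟩ := hF v₀ hv₀
    by_cases hx : p ∣ v₀.1
    · have hy : ¬ p ∣ v₀.2 := fun h => h2 ⟨hx, h⟩
      have hc : p ∣ c := by
        obtain ⟨x, hx⟩ := hx
        have h3 : p ∣ c * v₀.2 ^ 2 := by
          refine ⟨p ^ n * M - a * x * v₀.1 - b * x * v₀.2, ?_⟩
          simp only [binForm] at h1
          linear_combination h1 - (a * v₀.1 + b * v₀.2) * hx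
        exact (hp.dvd_or_dvd h3).resolve_right fun h => hy (hp.dvd_of_dvd_pow h)
      rw [← Finset.card_image_of_injective _ Prod.swap_injective]
      refine aux c b a (coeff_pos_of_posDef ha hd) (by linarith) hc _ fun w hw => ?_
      obtain ⟨v, hv, rfl⟩ := Finset.mem_image.1 hw
      exact ⟨(binForm_swap _ _ _ v).trans (hF v hv).1, fun h => (hF v hv).2 ⟨h.2, h.1⟩⟩
    · obtain ⟨t, s, hts⟩ := exists_lift_slope (a := -v₀.2) hp hx
      have hQ : p ∣ binForm a b c (1, t) := by
        have h3 : p ∣ v₀.1 ^ 2 * binForm a b c (1, t) := by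
          refine ⟨p ^ n * M + b * v₀.1 * s + c * s * (v₀.1 * t + v₀.2), ?_⟩
          simp only [binForm] at h1 ⊢
          linear_combination h1 + (b * v₀.1 + c * (v₀.1 * t + v₀.2)) * hts
        exact (hp.dvd_or_dvd h3).resolve_left fun h => hx (hp.dvd_of_dvd_pow h)
      have hinj : Function.Injective (fun v : ℤ × ℤ => (v.1, v.2 - t * v.1)) := by
        intro v w h
        simp only [Prod.mk.injEq] at h
        obtain ⟨h3, h4⟩ := h
        rw [h3] at h4
        exact Prod.ext h3 (by linarith)
      rw [← Finset.card_image_of_injective _ hinj]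
      refine aux (binForm a b c (1, t)) (b + 2 * c * t) c ?_ ?_ hQ _ fun w hw => ?_
      · refine lt_of_le_of_ne (binForm_nonneg ha hd _) fun h => ?_
        have := binForm_eq_zero ha hd h.symm
        simp at this
      · have : (b + 2 * c * t) ^ 2 - 4 * binForm a b c (1, t) * c = b ^ 2 - 4 * a * c := by
          simp only [binForm]; ring
        linarith
      · obtain ⟨v, hv, rfl⟩ := Finset.mem_image.1 hw
        obtain ⟨h3, h4⟩ := hF v hv
        refine ⟨?_, fun h => h4 ⟨h.1, ?_⟩⟩
        · rw [← h3]
          simp only [binForm]; ring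
        · have : v.2 = (v.2 - t * v.1) + t * v.1 := by ring
          rw [this]
          exact dvd_add h.2 (h.1.mul_left t)

lemma RepBound.mul_prime_pow {p : ℤ} (hp : Prime p) (hpos : 0 < p) {B : ℝ} {M : ℤ}
    (hM : ¬ p ∣ M) (hB : RepBound B M) (n : ℕ) : RepBound ((n + 2) * B) (p ^ n * M) := by
  have hB0 := hB.nonneg
  have hp0 : p ≠ 0 := hp.ne_zero
  induction n using Nat.strong_induction_on with
  | _ n ih =>
    intro a b c ha hd F hF
    have h1 : ((F.filter (fun v => ¬ (p ∣ v.1 ∧ p ∣ v.2))).card : ℝ) ≤ 2 * B :=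
      card_primitive_le hp hpos hB n a b c ha hd _ fun v hv =>
        ⟨hF v (Finset.mem_filter.1 hv).1, (Finset.mem_filter.1 hv).2⟩
    have h2 : ((F.filter (fun v => p ∣ v.1 ∧ p ∣ v.2)).card : ℝ) ≤ n * B := by
      have key : ∀ v ∈ F.filter (fun v => p ∣ v.1 ∧ p ∣ v.2),
          p ^ 2 * binForm a b c (v.1 / p, v.2 / p) = p ^ n * M := by
        intro v hv
        obtain ⟨hv, ⟨x, hx⟩, ⟨y, hy⟩⟩ := Finset.mem_filter.1 hv
        rw [hx, hy, Int.mul_ediv_cancel_left _ hp0, Int.mul_ediv_cancel_left _ hp0, ← hF v hv]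
        simp only [binForm]
        rw [hx, hy]
        ring
      rcases lt_or_ge n 2 with hn | hn
      · have : F.filter (fun v => p ∣ v.1 ∧ p ∣ v.2) = ∅ := by
          rw [Finset.eq_empty_iff_forall_notMem]
          intro v hv
          have h3 := key v hv
          apply hM
          interval_cases n
          · refine ⟨p * binForm a b c (v.1 / p, v.2 / p), ?_⟩
            linear_combination -h3
          · refine ⟨binForm a b c (v.1 / p, v.2 / p), ?_⟩
            apply mul_left_cancel₀ hp0
            linear_combination -h3
        rw [this]
        simp only [Finset.card_empty, Nat.cast_zero]
        positivity
      · obtain ⟨m, rfl⟩ := Nat.exists_eq_add_of_le hn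
        have hinj : Set.InjOn (fun v : ℤ × ℤ => (v.1 / p, v.2 / p))
            (F.filter (fun v => p ∣ v.1 ∧ p ∣ v.2)) := by
          intro v hv w hw h
          obtain ⟨-, hv1, hv2⟩ := Finset.mem_filter.1 hv
          obtain ⟨-, hw1, hw2⟩ := Finset.mem_filter.1 hw
          simp only [Prod.mk.injEq] at h
          refine Prod.ext ?_ ?_
          · rw [← Int.mul_ediv_cancel' hv1, h.1, Int.mul_ediv_cancel' hw1]
          · rw [← Int.mul_ediv_cancel' hv2, h.2, Int.mul_ediv_cancel' hw2]
        rw [← Finset.card_image_of_injOn hinj]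
        refine (ih m (by omega) a b c ha hd _ fun w hw => ?_).trans (le_of_eq ?_)
        · obtain ⟨v, hv, rfl⟩ := Finset.mem_image.1 hw
          have h3 := key v hv
          apply mul_left_cancel₀ (pow_ne_zero 2 hp0)
          rw [h3]
          ring
        · push_cast; ring
    have h3 := Finset.card_filter_add_card_filter_not (s := F) (fun v => p ∣ v.1 ∧ p ∣ v.2)
    have h4 : (F.card : ℝ) = ((F.filter (fun v => p ∣ v.1 ∧ p ∣ v.2)).card : ℝ) +
        ((F.filter (fun v => ¬ (p ∣ v.1 ∧ p ∣ v.2))).card : ℝ) := by exact_mod_cast h3.symm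
    linarith

lemma exists_add_two_le_rpow {δ : ℝ} (hδ : 0 < δ) : ∃ K : ℝ, 1 ≤ K ∧ ∃ P : ℕ, ∀ p n : ℕ, 2 ≤ p →
    0 < n → (n + 2 : ℝ) ≤ (if p < P then K else 1) * ((p : ℝ) ^ n) ^ δ := by
  have hl := Real.log_pos one_lt_two
  refine ⟨2 + 1 / (δ * Real.log 2), by have : 0 < 1 / (δ * Real.log 2) := by positivity
                                       linarith, ⌈(3 : ℝ) ^ (1 / δ)⌉₊, ?_⟩
  intro p n hp hn
  have hp' : (2 : ℝ) ≤ p := by exact_mod_cast hp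
  have hn' : (1 : ℝ) ≤ n := by exact_mod_cast hn
  have hswap : ((p : ℝ) ^ n) ^ δ = ((p : ℝ) ^ δ) ^ n := by
    rw [← Real.rpow_natCast, ← Real.rpow_mul (by positivity), mul_comm, Real.rpow_mul (by positivity),
      Real.rpow_natCast]
  split_ifs with h
  · have h1 : 1 + n * (δ * Real.log 2) ≤ ((p : ℝ) ^ n) ^ δ := by
      calc 1 + n * (δ * Real.log 2) ≤ Real.exp (n * (δ * Real.log 2)) := by
            linarith [Real.add_one_le_exp (n * (δ * Real.log 2))]
        _ = ((2 : ℝ) ^ n) ^ δ := by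
            rw [← Real.rpow_natCast, ← Real.rpow_mul (by positivity),
              Real.rpow_def_of_pos (by positivity)]
            congr 1; ring
        _ ≤ _ := by gcongr
    have h2 : (n + 2 : ℝ) ≤ (2 + 1 / (δ * Real.log 2)) * (1 + n * (δ * Real.log 2)) := by
      have e : 1 / (δ * Real.log 2) * (n * (δ * Real.log 2)) = n := by field_simp
      have e1 : 0 < 1 / (δ * Real.log 2) := by positivity
      have e2 : 0 ≤ n * (δ * Real.log 2) := by positivity
      nlinarith
    exact h2.trans (by gcongr)
  · rw [one_mul, hswap]
    have h1 : (3 : ℝ) ≤ (p : ℝ) ^ δ := by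
      have h2 : (3 : ℝ) ^ (1 / δ) ≤ p := (Nat.le_ceil _).trans (by exact_mod_cast not_lt.1 h)
      calc (3 : ℝ) = ((3 : ℝ) ^ (1 / δ)) ^ δ := by
            rw [← Real.rpow_mul (by norm_num), one_div_mul_cancel hδ.ne', Real.rpow_one]
        _ ≤ _ := by gcongr
    have h2 : ∀ m : ℕ, (m + 3 : ℝ) ≤ 3 ^ (m + 1) := by
      intro m
      induction m with
      | zero => norm_num
      | succ m ih => rw [pow_succ]; push_cast; linarith
    obtain ⟨m, rfl⟩ := Nat.exists_eq_succ_of_ne_zero hn.ne'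
    calc ((m.succ : ℕ) + 2 : ℝ) = m + 3 := by push_cast; ring
      _ ≤ 3 ^ (m + 1) := h2 m
      _ ≤ _ := by gcongr

/-- The number of representations of `M` by a positive definite binary quadratic form grows more
slowly than any power of `M`, uniformly in the form. -/
lemma exists_repBound {δ : ℝ} (hδ : 0 < δ) : ∃ C : ℝ, 0 < C ∧ ∀ M : ℕ, 0 < M →
    RepBound (C * (M : ℝ) ^ δ) M := by
  obtain ⟨K, hK, P, hKP⟩ := exists_add_two_le_rpow hδ
  set w : ℕ → ℝ := fun p => if p < P then K else 1 with hw
  have hw1 (p : ℕ) : 1 ≤ w p := by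
    simp only [hw]; split_ifs
    · exact hK
    · exact le_rfl
  have hprod (M : ℕ) : ∏ p ∈ M.primeFactors, w p ≤ K ^ P := by
    calc ∏ p ∈ M.primeFactors, w p = ∏ p ∈ M.primeFactors with p < P, K := by
          rw [Finset.prod_filter]
      _ = K ^ (M.primeFactors.filter (fun p => p < P)).card := by rw [Finset.prod_const]
      _ ≤ K ^ P := by
          refine pow_le_pow_right₀ hK ?_
          calc _ ≤ (Finset.range P).card := Finset.card_le_card fun p hp =>
                Finset.mem_range.2 (Finset.mem_filter.1 hp).2
            _ = P := Finset.card_range P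
  have key : ∀ M : ℕ, 0 < M → RepBound (8 * (∏ p ∈ M.primeFactors, w p) * (M : ℝ) ^ δ) M := by
    intro M
    induction M using Nat.recOnPrimePow with
    | zero => intro h; exact absurd h (lt_irrefl 0)
    | one => intro _; simpa using repBound_one
    | prime_pow_mul M p n hp hpM hn ih =>
      intro h
      have hM : 0 < M := Nat.pos_of_mul_pos_left h
      have h1 := (ih hM).mul_prime_pow (Nat.prime_iff_prime_int.1 hp) (by exact_mod_cast hp.pos)
        (by exact_mod_cast hpM) n
      have hpf : (p ^ n * M).primeFactors = insert p M.primeFactors := by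
        rw [Nat.primeFactors_mul (pow_ne_zero _ hp.ne_zero) hM.ne', Nat.primeFactors_prime_pow hn.ne' hp]
        rfl
      intro a b c ha hd F hF
      refine (h1 a b c ha hd F (by simpa using hF)).trans ?_
      rw [hpf, Finset.prod_insert (by simp [hpM])]
      push_cast
      rw [Real.mul_rpow (by positivity) (by positivity)]
      have h2 := hKP p n hp.two_le hn
      have h3 : 0 ≤ 8 * (∏ p ∈ M.primeFactors, w p) * (M : ℝ) ^ δ := (ih hM).nonneg
      calc _ ≤ (w p * ((p : ℝ) ^ n) ^ δ) * (8 * (∏ p ∈ M.primeFactors, w p) * (M : ℝ) ^ δ) := by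
            gcongr
        _ = _ := by ring
  refine ⟨8 * K ^ P, by positivity, fun M hM a b c ha hd F hF => ?_⟩
  refine (key M hM a b c ha hd F hF).trans ?_
  gcongr
  exact hprod M

/-! ### Lattice points near two Fermi spheres -/

lemma sum_fin_three_cyclic (f : Fin 3 → ℤ) (j : Fin 3) :
    ∑ i, f i = f j + f (j + 1) + f (j + 2) := by
  rw [Fin.sum_univ_three]
  fin_cases j
  · rfl
  · change f 0 + f 1 + f 2 = f 1 + f 2 + f 0
    ring
  · change f 0 + f 1 + f 2 = f 2 + f 0 + f 1
    ring

lemma lenSq_nonneg (p : Momentum) : 0 ≤ lenSq p := Finset.sum_nonneg fun _ _ => sq_nonneg _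

/-- The number of lattice points on the intersection of two spheres. -/
lemma exists_card_sphere_inter_le {δ : ℝ} (hδ : 0 < δ) : ∃ C : ℝ, 0 < C ∧ ∀ k : Momentum, k ≠ 0 →
    ∀ m₁ m₂ : ℤ, ∀ X : ℝ, 1 ≤ X → (m₁ : ℝ) ≤ X → (m₂ : ℝ) ≤ X → ∀ F : Finset Momentum,
      (∀ p ∈ F, lenSq p = m₁ ∧ lenSq (p - k) = m₂) → (F.card : ℝ) ≤ C * X ^ δ := by
  obtain ⟨C, hC, hrep⟩ := exists_repBound (δ := δ / 4) (by positivity)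
  refine ⟨1 + C * 256 ^ (δ / 4), by positivity, ?_⟩
  intro k hk m₁ m₂ X hX hm₁ hm₂ F hF
  have hX0 : 0 < X := by linarith
  have hXδ : 1 ≤ X ^ δ := Real.one_le_rpow hX hδ.le
  rcases F.eq_empty_or_nonempty with rfl | ⟨p₀, hp₀⟩
  · simp only [Finset.card_empty, Nat.cast_zero]
    positivity
  obtain ⟨j, hj⟩ := Function.ne_iff.1 hk
  have hsq (p : Momentum) : lenSq p = p j ^ 2 + p (j + 1) ^ 2 + p (j + 2) ^ 2 :=
    sum_fin_three_cyclic (fun i => p i ^ 2) j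
  set A := k j with hA
  set B := k (j + 1) with hB
  set Γ := k (j + 2) with hΓ
  have hA0 : A ≠ 0 := hj
  set D := A ^ 2 + B ^ 2 + Γ ^ 2 with hD
  have hAsq : 0 < A ^ 2 := by positivity
  have hD0 : 0 < D := by positivity
  have hAD : A ^ 2 ≤ D := by nlinarith [sq_nonneg B, sq_nonneg Γ]
  set n := m₁ - m₂ + D with hn
  have hmem : ∀ p ∈ F, m₁ = p j ^ 2 + p (j + 1) ^ 2 + p (j + 2) ^ 2 ∧
      n = 2 * (A * p j + B * p (j + 1) + Γ * p (j + 2)) := by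
    intro p hp
    obtain ⟨h1, h2⟩ := hF p hp
    rw [hsq] at h1 h2
    simp only [Pi.sub_apply] at h2
    refine ⟨h1.symm, ?_⟩
    rw [hn, ← h1, ← h2]
    ring
  have hD4 : (D : ℝ) ≤ 4 * X := by
    have h1 : D ≤ 2 * (m₁ + m₂) := by
      obtain ⟨h1, h2⟩ := hF p₀ hp₀
      rw [← h1, ← h2, hsq, hsq]
      simp only [Pi.sub_apply]
      rw [← hA, ← hB, ← hΓ]
      nlinarith [sq_nonneg (2 * p₀ j - A), sq_nonneg (2 * p₀ (j + 1) - B),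
        sq_nonneg (2 * p₀ (j + 2) - Γ)]
    have h2 : (D : ℝ) ≤ 2 * (m₁ + m₂) := by exact_mod_cast h1
    linarith
  have hm₁0 : 0 ≤ m₁ := (hF p₀ hp₀).1 ▸ lenSq_nonneg p₀
  set a := A ^ 2 + B ^ 2 with ha
  set b := 2 * B * Γ with hb
  set c := A ^ 2 + Γ ^ 2 with hc
  have ha0 : 0 < a := by positivity
  have hd : b ^ 2 < 4 * a * c := by
    have : 4 * a * c - b ^ 2 = 4 * A ^ 2 * D := by rw [ha, hb, hc, hD]; ring
    have h2 : 0 < 4 * A ^ 2 * D := by positivity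
    linarith
  set M := A ^ 2 * (4 * D ^ 2 * m₁ - n ^ 2 * D) with hM
  set φ : Momentum → ℤ × ℤ := fun p => (2 * D * p (j + 1) - n * B, 2 * D * p (j + 2) - n * Γ) with hφ
  have hφM : ∀ p ∈ F, binForm a b c (φ p) = M := by
    intro p hp
    obtain ⟨h1, h2⟩ := hmem p hp
    simp only [binForm, hφ, hM, ha, hb, hc]
    rw [h1, h2, hD]
    ring
  have hinj : Set.InjOn φ F := by
    intro p hp q hq h
    simp only [hφ, Prod.mk.injEq] at h
    obtain ⟨h1, h2⟩ := h
    have e1 : p (j + 1) = q (j + 1) := by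
      have : (2 * D) * p (j + 1) = (2 * D) * q (j + 1) := by linarith
      exact mul_left_cancel₀ (by positivity) this
    have e2 : p (j + 2) = q (j + 2) := by
      have : (2 * D) * p (j + 2) = (2 * D) * q (j + 2) := by linarith
      exact mul_left_cancel₀ (by positivity) this
    have e3 : p j = q j := by
      have h3 := (hmem p hp).2
      rw [(hmem q hq).2, e1, e2] at h3
      have : A * p j = A * q j := by linarith
      exact mul_left_cancel₀ hA0 this
    have h0 : lenSq (p - q) = 0 := by
      rw [hsq]; simp [e1, e2, e3]
    by_contra hne
    exact (lenSq_pos (sub_ne_zero.2 hne)).ne' h0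
  have hM0 : 0 ≤ M := hφM p₀ hp₀ ▸ binForm_nonneg ha0 hd _
  rcases hM0.eq_or_lt with h0 | h0
  · have : F.card ≤ 1 := by
      refine Finset.card_le_one.2 fun p hp q hq => hinj hp hq ?_
      rw [binForm_eq_zero ha0 hd ((hφM p hp).trans h0.symm),
        binForm_eq_zero ha0 hd ((hφM q hq).trans h0.symm)]
    have h1 : (F.card : ℝ) ≤ 1 := by exact_mod_cast this
    have h2 : 0 < C * 256 ^ (δ / 4) := by positivity
    nlinarith
  · have hMn : ((M.toNat : ℕ) : ℤ) = M := Int.toNat_of_nonneg hM0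
    have h1 := hrep M.toNat (by omega) a b c ha0 hd (F.image φ) (by
      intro v hv
      obtain ⟨p, hp, rfl⟩ := Finset.mem_image.1 hv
      rw [hφM p hp, hMn])
    rw [Finset.card_image_of_injOn hinj] at h1
    have h2 : ((M.toNat : ℕ) : ℝ) = (M : ℝ) := by exact_mod_cast hMn
    rw [h2] at h1
    have h3 : (M : ℝ) ≤ 256 * X ^ 4 := by
      have e0 : M ≤ 4 * D ^ 3 * m₁ := by
        have f1 : M ≤ A ^ 2 * (4 * D ^ 2 * m₁) := by
          rw [hM]
          have : 0 ≤ n ^ 2 * D := by positivity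
          gcongr
          linarith
        have f2 : A ^ 2 * (4 * D ^ 2 * m₁) ≤ D * (4 * D ^ 2 * m₁) := by gcongr
        calc M ≤ _ := f1
          _ ≤ _ := f2
          _ = _ := by ring
      have e1 : (M : ℝ) ≤ 4 * (D : ℝ) ^ 3 * m₁ := by exact_mod_cast e0
      have e2 : (0 : ℝ) ≤ D := by exact_mod_cast hD0.le
      have e3 : (0 : ℝ) ≤ m₁ := by exact_mod_cast hm₁0
      calc (M : ℝ) ≤ _ := e1
        _ ≤ 4 * (4 * X) ^ 3 * X := by gcongr
        _ = _ := by ring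
    have hMr : (0 : ℝ) ≤ M := by exact_mod_cast hM0
    calc (F.card : ℝ) ≤ C * (M : ℝ) ^ (δ / 4) := h1
      _ ≤ C * (256 * X ^ 4) ^ (δ / 4) := by gcongr
      _ = C * 256 ^ (δ / 4) * X ^ δ := by
          rw [Real.mul_rpow (by norm_num) (by positivity), ← Real.rpow_natCast X,
            ← Real.rpow_mul hX0.le, mul_assoc]
          congr 3
          push_cast
          ring
      _ ≤ _ := by
          gcongr
          linarith

/-- The momenta with a gap to the Fermi sphere. -/
def IsGapped (kF δ : ℝ) (p : Momentum) : Prop := (particleNumber kF : ℝ) ^ (-δ) < |len p - kF|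

lemma abs_lenSq_sub_le {kF ε : ℝ} (h0 : 0 < kF) (hε : ε ≤ 1 / 3) {p : Momentum}
    (hp : ¬ IsGapped kF (1 / 3 - ε) p) :
    |(lenSq p : ℝ) - kF ^ 2| ≤ 5 * (particleNumber kF : ℝ) ^ ε := by
  have hN : (0 : ℝ) < particleNumber kF := by exact_mod_cast one_le_particleNumber h0
  have hN1 : (1 : ℝ) ≤ particleNumber kF := by exact_mod_cast one_le_particleNumber h0
  rw [IsGapped, not_lt] at hp
  set x := (particleNumber kF : ℝ) ^ (-(1 / 3 - ε)) with hx
  set y := (particleNumber kF : ℝ) ^ (1 / 3 : ℝ) with hy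
  have hxy : x * y = (particleNumber kF : ℝ) ^ ε := by
    rw [hx, hy, ← Real.rpow_add hN]
    congr 1
    ring
  have hx0 : 0 < x := Real.rpow_pos_of_pos hN _
  have hx1 : x ≤ 1 := Real.rpow_le_one_of_one_le_of_nonpos hN1 (by linarith)
  have hy1 : 1 ≤ y := one_le_rpow_particleNumber h0 (by norm_num)
  have hk : kF ≤ 2 * y := kF_le h0
  have hl := len_nonneg p
  have e1 : (lenSq p : ℝ) - kF ^ 2 = (len p - kF) * (len p + kF) := by rw [← len_sq]; ring
  have e2 : len p + kF ≤ 5 * y := by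
    have := (abs_le.1 hp).2
    linarith
  rw [e1, abs_mul, abs_of_nonneg (by linarith : 0 ≤ len p + kF), ← hxy]
  calc _ ≤ x * (5 * y) := by gcongr
    _ = _ := by ring

/-- The number of momenta `p` such that both `p` and `p - k` are close to the Fermi sphere. -/
lemma exists_card_near_le {ε δ : ℝ} (hε0 : 0 < ε) (hε : ε ≤ 1 / 3) (hδ : 0 < δ) :
    ∃ C : ℝ, 0 < C ∧ ∀ kF : ℝ, 0 < kF → ∀ k : Momentum, k ≠ 0 → ∀ F : Finset Momentum,
      (∀ p ∈ F, ¬ IsGapped kF (1 / 3 - ε) p ∧ ¬ IsGapped kF (1 / 3 - ε) (p - k)) →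
        (F.card : ℝ) ≤ C * (particleNumber kF : ℝ) ^ (2 * ε + δ) := by
  obtain ⟨C, hC, hcount⟩ := exists_card_sphere_inter_le hδ
  refine ⟨121 * (C * 9 ^ δ), by positivity, ?_⟩
  intro kF h0 k hk F hF
  have hN : (0 : ℝ) < particleNumber kF := by exact_mod_cast one_le_particleNumber h0
  have hN1 : (1 : ℝ) ≤ particleNumber kF := by exact_mod_cast one_le_particleNumber h0
  set N := (particleNumber kF : ℝ) with hNdef
  have hNε : 1 ≤ N ^ ε := Real.one_le_rpow hN1 hε0.le
  set I := Finset.Icc ⌈kF ^ 2 - 5 * N ^ ε⌉ ⌊kF ^ 2 + 5 * N ^ ε⌋ with hI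
  have hmemI : ∀ p, ¬ IsGapped kF (1 / 3 - ε) p → lenSq p ∈ I := by
    intro p hp
    have := abs_le.1 (abs_lenSq_sub_le h0 hε hp)
    rw [hI, Finset.mem_Icc]
    exact ⟨Int.ceil_le.2 (by linarith), Int.le_floor.2 (by linarith)⟩
  have hIcard : (I.card : ℝ) ≤ 11 * N ^ ε := by
    rw [hI, Int.card_Icc]
    have h1 : (((⌊kF ^ 2 + 5 * N ^ ε⌋ + 1 - ⌈kF ^ 2 - 5 * N ^ ε⌉).toNat : ℤ) : ℝ) ≤ 11 * N ^ ε := by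
      rw [Int.ofNat_toNat]
      push_cast
      apply max_le
      · linarith [Int.floor_le (kF ^ 2 + 5 * N ^ ε), Int.le_ceil (kF ^ 2 - 5 * N ^ ε)]
      · positivity
    exact_mod_cast h1
  have hX : kF ^ 2 + 5 * N ^ ε ≤ 9 * N := by
    have h1 := kF_le h0
    have h2 : (N ^ (1 / 3 : ℝ)) ^ 2 ≤ N := by
      rw [← Real.rpow_natCast, ← Real.rpow_mul hN.le]
      nth_rewrite 2 [← Real.rpow_one N]
      exact Real.rpow_le_rpow_of_exponent_le hN1 (by norm_num)
    have h3 : N ^ ε ≤ N := by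
      nth_rewrite 2 [← Real.rpow_one N]
      exact Real.rpow_le_rpow_of_exponent_le hN1 (by linarith)
    have h4 : kF ^ 2 ≤ (2 * N ^ (1 / 3 : ℝ)) ^ 2 := by gcongr
    nlinarith
  have hmaps : ∀ p ∈ F, (lenSq p, lenSq (p - k)) ∈ I ×ˢ I := fun p hp =>
    Finset.mk_mem_product (hmemI p (hF p hp).1) (hmemI _ (hF p hp).2)
  have hfib : ∀ m ∈ I ×ˢ I,
      ((F.filter (fun p => (lenSq p, lenSq (p - k)) = m)).card : ℝ) ≤ C * (9 * N) ^ δ := by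
    intro m hm
    have hle : ∀ z ∈ I, (z : ℝ) ≤ 9 * N := fun z hz =>
      (Int.le_floor.1 (Finset.mem_Icc.1 hz).2).trans hX
    obtain ⟨hm1, hm2⟩ := Finset.mem_product.1 hm
    refine hcount k hk m.1 m.2 (9 * N) (by linarith) (hle _ hm1) (hle _ hm2) _ fun p hp => ?_
    have := (Finset.mem_filter.1 hp).2
    exact ⟨congrArg Prod.fst this, congrArg Prod.snd this⟩
  have h1 : (F.card : ℝ) = ∑ m ∈ I ×ˢ I,
      ((F.filter (fun p => (lenSq p, lenSq (p - k)) = m)).card : ℝ) := by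
    exact_mod_cast Finset.card_eq_sum_card_fiberwise hmaps
  rw [h1]
  calc _ ≤ (I ×ˢ I).card • (C * (9 * N) ^ δ) := Finset.sum_le_card_nsmul _ _ _ hfib
    _ = (I.card : ℝ) * I.card * (C * (9 * N) ^ δ) := by
        rw [nsmul_eq_mul, Finset.card_product]; push_cast; ring
    _ ≤ (11 * N ^ ε) * (11 * N ^ ε) * (C * (9 * N) ^ δ) := by gcongr
    _ = _ := by
        rw [Real.mul_rpow (by norm_num) hN.le, Real.rpow_add hN, two_mul ε, Real.rpow_add hN]
        ring

/-! ### Bounds on the non-bosonizable operators -/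

/-- The coefficients of `a_q^* a_{q+k} ξ`. -/
def hop (k : Momentum) (ξ : Fock) (q : Momentum) (S : Finset Momentum) : ℂ :=
  create q (annihilate (q + k) ξ) S

lemma norm_hop_sq {k : Momentum} (hk : k ≠ 0) (ξ : Fock) (q : Momentum) (S : Finset Momentum) :
    ‖hop k ξ q S‖ ^ 2 =
      if q ∈ S ∧ q + k ∉ S then ‖ξ (insert (q + k) (S.erase q))‖ ^ 2 else 0 := by
  have hne : q + k ≠ q := by simpa using hk
  rw [hop, create_apply, annihilate_apply]
  by_cases h1 : q ∈ S <;> by_cases h2 : q + k ∈ S <;>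
    simp [h1, h2, hne, norm_fermiSign]

open Classical in
lemma nonBosonizableFun_eq (kF : ℝ) (k : Momentum) (ξ : Fock) (S : Finset Momentum) :
    nonBosonizableFun kF k ξ S =
      ∑ q ∈ S with q ∉ fermiBall kF ∧ q + k ∉ fermiBall kF, hop k ξ q S
        - ∑ q ∈ S with q ∈ fermiBall kF ∧ q + -k ∈ fermiBall kF, hop (-k) ξ q S := by
  rw [nonBosonizableFun]
  congr 1
  · set f : Momentum → ℂ := fun p => if p ∉ fermiBall kF ∧ p - k ∉ fermiBall kF then
      create (p - k) (annihilate p ξ) S else 0 with hf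
    have h1 : (∑' p : {p : Momentum // p ∉ fermiBall kF ∧ p - k ∉ fermiBall kF},
        create (p.1 - k) (annihilate p.1 ξ) S) = ∑' p, f p := by
      have := tsum_subtype {p : Momentum | p ∉ fermiBall kF ∧ p - k ∉ fermiBall kF}
        (fun p => create (p - k) (annihilate p ξ) S)
      refine this.trans (tsum_congr fun p => ?_)
      simp only [hf, Set.indicator_apply, Set.mem_ofPred_eq]
    rw [h1, ← (Equiv.addRight k).tsum_eq f, tsum_eq_sum (s := S), Finset.sum_filter]
    · refine Finset.sum_congr rfl fun q _ => ?_
      simp only [hf, Equiv.coe_addRight, add_sub_cancel_right, hop]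
      exact if_congr and_comm rfl rfl
    · intro q hq
      simp only [hf, Equiv.coe_addRight, add_sub_cancel_right]
      rw [create_apply, if_neg hq, ite_self]
  · rw [← Finset.sum_filter_of_ne (p := fun h => h + k ∈ S)]
    · refine Finset.sum_nbij' (fun h => h + k) (fun q => q - k) ?_ ?_ ?_ ?_ ?_
      · intro h hh
        simp only [Finset.mem_filter] at hh ⊢
        refine ⟨hh.2, hh.1.2, ?_⟩
        simpa using hh.1.1
      · intro q hq
        simp only [Finset.mem_filter] at hq ⊢
        rw [sub_add_cancel, sub_eq_add_neg]
        exact ⟨⟨hq.2.2, hq.2.1⟩, hq.1⟩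
      · intro h _; simp
      · intro q _; simp
      · intro h _
        simp only [hop, add_neg_cancel_right]
    · intro h _ hne
      by_contra hS
      exact hne (by rw [create_apply, if_neg hS])

/-- The squared modulus, as an extended nonnegative number. -/
def esq (z : ℂ) : ENNReal := ENNReal.ofReal (‖z‖ ^ 2)

lemma esq_add_le (z w : ℂ) : esq (z + w) ≤ 2 * (esq z + esq w) := by
  have h : ‖z + w‖ ^ 2 ≤ 2 * (‖z‖ ^ 2 + ‖w‖ ^ 2) := by
    have h1 : ‖z + w‖ ^ 2 ≤ (‖z‖ + ‖w‖) ^ 2 := by gcongr; exact norm_add_le z w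
    nlinarith [sq_nonneg (‖z‖ - ‖w‖)]
  rw [esq, esq, esq, ← ENNReal.ofReal_add (by positivity) (by positivity),
    show (2 : ENNReal) = ENNReal.ofReal 2 by simp, ← ENNReal.ofReal_mul (by norm_num)]
  exact ENNReal.ofReal_le_ofReal h

lemma esq_neg (z : ℂ) : esq (-z) = esq z := by rw [esq, esq, norm_neg]

lemma esq_sum_le {ι : Type*} (s : Finset ι) (f : ι → ℂ) :
    esq (∑ i ∈ s, f i) ≤ s.card * ∑ i ∈ s, esq (f i) := by
  have h : ‖∑ i ∈ s, f i‖ ^ 2 ≤ s.card * ∑ i ∈ s, ‖f i‖ ^ 2 := by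
    calc ‖∑ i ∈ s, f i‖ ^ 2 ≤ (∑ i ∈ s, ‖f i‖) ^ 2 := by gcongr; exact norm_sum_le _ _
      _ ≤ _ := sq_sum_le_card_mul_sum_sq
  simp only [esq]
  rw [← ENNReal.ofReal_sum_of_nonneg fun i _ => by positivity, ← ENNReal.ofReal_natCast,
    ← ENNReal.ofReal_mul (by positivity)]
  exact ENNReal.ofReal_le_ofReal h

/-- A sum of hopping terms, bounded by weights that are compatible with the hops. -/
lemma tsum_esq_hop_le {k : Momentum} (hk : k ≠ 0) (ξ : Fock) (P : Momentum → Prop)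
    [DecidablePred P] (w w' : Finset Momentum → ℕ) (hw : ∀ S, (S.filter P).card ≤ w S)
    (hw' : ∀ S q, q ∈ S → q + k ∉ S → P q → w S ≤ w' (insert (q + k) (S.erase q))) :
    ∑' S, esq (∑ q ∈ S with P q, hop k ξ q S) ≤
      ∑' T : Finset Momentum, (w' T * (T.filter (fun p => P (p - k))).card : ENNReal) * esq (ξ T) := by
  have hne (q : Momentum) : q + k ≠ q := by simpa using hk
  set A : Momentum → Set (Finset Momentum) := fun q => {S | q ∈ S ∧ q + k ∉ S ∧ P q} with hA
  set g : Momentum → Finset Momentum → ENNReal :=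
    fun q T => if q + k ∈ T ∧ P q then (w' T : ENNReal) * esq (ξ T) else 0 with hg
  have h1 (S : Finset Momentum) : esq (∑ q ∈ S with P q, hop k ξ q S) ≤
      ∑' q, (A q).indicator (fun S => (w S : ENNReal) * esq (ξ (insert (q + k) (S.erase q)))) S := by
    refine (esq_sum_le _ _).trans ?_
    rw [tsum_eq_sum (s := S.filter P), Finset.mul_sum]
    · refine Finset.sum_le_sum fun q hq => ?_
      obtain ⟨hq, hP⟩ := Finset.mem_filter.1 hq
      rw [esq, norm_hop_sq hk]
      by_cases hqk : q + k ∈ S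
      · simp [hqk]
      · rw [if_pos ⟨hq, hqk⟩, Set.indicator_of_mem (show S ∈ A q from ⟨hq, hqk, hP⟩)]
        gcongr
        · exact hw S
        · exact le_rfl
    · intro q hq
      refine Set.indicator_of_notMem (fun h => hq ?_) _
      exact Finset.mem_filter.2 ⟨h.1, h.2.2⟩
  have h2 (q : Momentum) :
      ∑' S, (A q).indicator (fun S => (w S : ENNReal) * esq (ξ (insert (q + k) (S.erase q)))) S ≤
        ∑' T, g q T := by
    rw [← tsum_subtype]
    have hinj : Function.Injective (fun S : A q => insert (q + k) (S.1.erase q)) := by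
      rintro ⟨S, hS1, hS2, _⟩ ⟨T, hT1, hT2, _⟩ h
      replace h : insert (q + k) (S.erase q) = insert (q + k) (T.erase q) := h
      apply Subtype.ext
      have e1 : q + k ∉ S.erase q := fun h => hS2 (Finset.mem_of_mem_erase h)
      have e2 : q + k ∉ T.erase q := fun h => hT2 (Finset.mem_of_mem_erase h)
      have e3 : S.erase q = T.erase q := by
        rw [← Finset.erase_insert e1, h, Finset.erase_insert e2]
      change S = T
      rw [← Finset.insert_erase hS1, e3, Finset.insert_erase hT1]
    refine le_trans (ENNReal.tsum_le_tsum fun S => ?_)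
      (ENNReal.tsum_comp_le_tsum_of_injective hinj (g q))
    obtain ⟨S, hS1, hS2, hP⟩ := S
    simp only [hg]
    rw [if_pos ⟨Finset.mem_insert_self _ _, hP⟩]
    gcongr
    exact hw' S q hS1 hS2 hP
  calc _ ≤ ∑' S, ∑' q, (A q).indicator
        (fun S => (w S : ENNReal) * esq (ξ (insert (q + k) (S.erase q)))) S :=
        ENNReal.tsum_le_tsum h1
    _ = ∑' q, ∑' S, (A q).indicator
        (fun S => (w S : ENNReal) * esq (ξ (insert (q + k) (S.erase q)))) S := ENNReal.tsum_comm
    _ ≤ ∑' q, ∑' T, g q T := ENNReal.tsum_le_tsum h2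
    _ = ∑' T, ∑' q, g q T := ENNReal.tsum_comm
    _ = _ := by
        refine tsum_congr fun T => ?_
        rw [← (Equiv.subRight k).tsum_eq, tsum_eq_sum (s := T.filter (fun p => P (p - k)))]
        · have : ∀ p ∈ T.filter (fun p => P (p - k)),
              g (Equiv.subRight k p) T = (w' T : ENNReal) * esq (ξ T) := by
            intro p hp
            have := Finset.mem_filter.1 hp
            simp only [hg, Equiv.subRight_apply, sub_add_cancel]
            rw [if_pos this]
          rw [Finset.sum_congr rfl this, Finset.sum_const, nsmul_eq_mul]
          ring
        · intro p hp
          simp only [hg, Equiv.subRight_apply, sub_add_cancel]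
          rw [if_neg]
          exact fun h => hp (Finset.mem_filter.2 h)

open Classical in
/-- Hopping terms in one direction: either both momenta are close to the Fermi surface, or one of
them is gapped. -/
lemma tsum_esq_hop_le_gapped {k : Momentum} (hk : k ≠ 0) (ξ : Fock) (R G : Momentum → Prop)
    [DecidablePred R] (n : ℕ)
    (hn : ∀ F : Finset Momentum, (∀ q ∈ F, ¬ G q ∧ ¬ G (q + k)) → F.card ≤ n) :
    ∑' S, esq (∑ q ∈ S with R q, hop k ξ q S) ≤
      12 * ∑' T : Finset Momentum,
        ((T.card * (T.filter G).card + (n + 1) * T.card : ℕ) : ENNReal) * esq (ξ T) := by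
  set W := ∑' T : Finset Momentum,
        ((T.card * (T.filter G).card + (n + 1) * T.card : ℕ) : ENNReal) * esq (ξ T) with hW
  have key : ∀ a b : Finset Momentum → ℕ,
      (∀ T, a T * b T ≤ T.card * (T.filter G).card + (n + 1) * T.card) →
      ∑' T, ((a T : ENNReal) * (b T : ENNReal)) * esq (ξ T) ≤ W := fun a b hab =>
    ENNReal.tsum_le_tsum fun T => mul_le_mul_left (by
      rw [← Nat.cast_mul]
      exact Nat.cast_le.2 (hab T)) _
  have h1 : ∑' S, esq (∑ q ∈ S with (R q ∧ ¬ G q ∧ ¬ G (q + k)), hop k ξ q S) ≤ W := by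
    refine (tsum_esq_hop_le hk ξ (fun q => R q ∧ ¬ G q ∧ ¬ G (q + k)) (fun _ => n) (fun _ => n)
      (fun S => hn _ fun q hq => (Finset.mem_filter.1 hq).2.2)
      (fun _ _ _ _ _ => le_rfl)).trans (key _ _ fun T => ?_)
    calc n * _ ≤ n * T.card := Nat.mul_le_mul_left _ (Finset.card_filter_le _ _)
      _ ≤ (n + 1) * T.card := Nat.mul_le_mul_right _ (Nat.le_succ n)
      _ ≤ _ := Nat.le_add_left _ _
  have h2 : ∑' S, esq (∑ q ∈ S with (R q ∧ G (q + k)), hop k ξ q S) ≤ W := by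
    refine (tsum_esq_hop_le hk ξ (fun q => R q ∧ G (q + k)) (fun S => S.card) (fun S => S.card)
      (fun S => Finset.card_filter_le _ _) (fun S q h1 h2 _ => ?_)).trans (key _ _ fun T => ?_)
    · rw [Finset.card_insert_of_notMem fun h => h2 (Finset.mem_of_mem_erase h),
        Finset.card_erase_add_one h1]
    · refine le_trans (Nat.mul_le_mul_left _ (Finset.card_le_card fun p hp => ?_))
        (Nat.le_add_right _ _)
      have := Finset.mem_filter.1 hp
      rw [sub_add_cancel] at this
      exact Finset.mem_filter.2 ⟨this.1, this.2.2⟩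
  have h3 : ∑' S, esq (∑ q ∈ S with (R q ∧ G q ∧ ¬ G (q + k)), hop k ξ q S) ≤ W := by
    refine (tsum_esq_hop_le hk ξ (fun q => R q ∧ G q ∧ ¬ G (q + k)) (fun S => (S.filter G).card)
      (fun S => (S.filter G).card + 1) (fun S => ?_) (fun S q h1 h2 h3 => ?_)).trans
      (key _ _ fun T => ?_)
    · exact Finset.card_le_card fun q hq => by
        have := Finset.mem_filter.1 hq
        exact Finset.mem_filter.2 ⟨this.1, this.2.2.1⟩
    · refine (Finset.card_le_card_sdiff_add_card (t := {q})).trans ?_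
      rw [Finset.card_singleton]
      refine Nat.add_le_add_right (Finset.card_le_card fun p hp => ?_) 1
      simp only [Finset.mem_sdiff, Finset.mem_filter, Finset.mem_singleton, Finset.mem_insert,
        Finset.mem_erase] at hp ⊢
      exact ⟨Or.inr ⟨hp.2, hp.1.1⟩, hp.1.2⟩
    · calc ((T.filter G).card + 1) * _ ≤ ((T.filter G).card + 1) * T.card :=
            Nat.mul_le_mul_left _ (Finset.card_filter_le _ _)
        _ = T.card * (T.filter G).card + 1 * T.card := by ring
        _ ≤ _ := Nat.add_le_add_left (Nat.mul_le_mul_right _ (by omega)) _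
  have hsplit (S : Finset Momentum) : ∑ q ∈ S with R q, hop k ξ q S =
      (∑ q ∈ S with (R q ∧ ¬ G q ∧ ¬ G (q + k)), hop k ξ q S +
        ∑ q ∈ S with (R q ∧ G (q + k)), hop k ξ q S) +
        ∑ q ∈ S with (R q ∧ G q ∧ ¬ G (q + k)), hop k ξ q S := by
    simp only [Finset.sum_filter]
    rw [← Finset.sum_add_distrib, ← Finset.sum_add_distrib]
    refine Finset.sum_congr rfl fun q _ => ?_
    by_cases e1 : R q <;> by_cases e2 : G q <;> by_cases e3 : G (q + k) <;> simp [e1, e2, e3]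
  calc _ ≤ ∑' S, (4 * esq (∑ q ∈ S with (R q ∧ ¬ G q ∧ ¬ G (q + k)), hop k ξ q S) +
        4 * esq (∑ q ∈ S with (R q ∧ G (q + k)), hop k ξ q S) +
        4 * esq (∑ q ∈ S with (R q ∧ G q ∧ ¬ G (q + k)), hop k ξ q S)) := by
        refine ENNReal.tsum_le_tsum fun S => ?_
        rw [hsplit]
        refine (esq_add_le _ _).trans ?_
        refine (mul_le_mul_right (add_le_add_left (esq_add_le _ _) _) 2).trans ?_
        rw [mul_add, ← mul_assoc, mul_add]
        gcongr <;> norm_num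
    _ ≤ 4 * W + 4 * W + 4 * W := by
        rw [ENNReal.tsum_add, ENNReal.tsum_add, ENNReal.tsum_mul_left, ENNReal.tsum_mul_left,
          ENNReal.tsum_mul_left]
        gcongr
    _ = 12 * W := by
        rw [← add_mul, ← add_mul]; norm_num

/-! ### Number operators -/

lemma hasSum_norm_annihilate (p : Momentum) (ξ : Fock) :
    HasSum (fun S => if p ∈ S then ‖ξ S‖ ^ 2 else 0) (‖annihilate p ξ‖ ^ 2) := by
  have h := (lp.hasSum_inner (𝕜 := ℂ) ξ (create p (annihilate p ξ))).mapL Complex.reCLM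
  have h1 : ⟪ξ, create p (annihilate p ξ)⟫_ℂ = ((‖annihilate p ξ‖ ^ 2 : ℝ) : ℂ) := by
    rw [create, ContinuousLinearMap.adjoint_inner_right, inner_self_eq_norm_sq_to_K]
    push_cast
    rfl
  rw [h1] at h
  simp only [Complex.reCLM_apply, Complex.ofReal_re] at h
  refine h.congr_fun fun S => ?_
  rw [create_annihilate_apply]
  split_ifs
  · rw [inner_self_eq_norm_sq_to_K]
    exact_mod_cast rfl
  · simp

lemma tsum_norm_annihilate (Q : Momentum → Prop) [DecidablePred Q] (ξ : Fock) :
    ∑' p : {p : Momentum // Q p}, ‖annihilate p.1 ξ‖ ^ 2 =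
      ∑' S : Finset Momentum, ((S.filter Q).card : ℝ) * ‖ξ S‖ ^ 2 := by
  have h1 (p : Momentum) : ENNReal.ofReal (‖annihilate p ξ‖ ^ 2) =
      ∑' S, if p ∈ S then esq (ξ S) else 0 := by
    rw [← (hasSum_norm_annihilate p ξ).tsum_eq, ENNReal.ofReal_tsum_of_nonneg]
    · refine tsum_congr fun S => ?_
      split_ifs
      · rfl
      · simp
    · intro S; positivity
    · exact (hasSum_norm_annihilate p ξ).summable
  have h2 : ∑' p : {p : Momentum // Q p}, ENNReal.ofReal (‖annihilate p.1 ξ‖ ^ 2) =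
      ∑' S : Finset Momentum, ((S.filter Q).card : ENNReal) * esq (ξ S) := by
    simp only [h1]
    rw [ENNReal.tsum_comm]
    refine tsum_congr fun S => ?_
    have e := tsum_subtype {p : Momentum | Q p} (fun p => if p ∈ S then esq (ξ S) else 0)
    refine e.trans ?_
    rw [tsum_eq_sum (s := S.filter Q)]
    · rw [Finset.sum_congr rfl (g := fun _ => esq (ξ S)), Finset.sum_const, nsmul_eq_mul]
      intro p hp
      obtain ⟨h3, h4⟩ := Finset.mem_filter.1 hp
      rw [Set.indicator_of_mem (show p ∈ {p : Momentum | Q p} from h4), if_pos h3]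
    · intro p hp
      rw [Set.indicator_apply_eq_zero]
      intro hQ
      exact if_neg fun hS => hp (Finset.mem_filter.2 ⟨hS, hQ⟩)
  have h3 := congrArg ENNReal.toReal h2
  have h4 (S : Finset Momentum) : ((S.filter Q).card : ENNReal) * esq (ξ S) ≠ ⊤ :=
    ENNReal.mul_ne_top (ENNReal.natCast_ne_top _) ENNReal.ofReal_ne_top
  rw [ENNReal.tsum_toReal_eq fun _ => ENNReal.ofReal_ne_top, ENNReal.tsum_toReal_eq h4] at h3
  simpa [esq] using h3

lemma numberForm_eq (ξ : Fock) :
    numberForm ξ = ∑' S : Finset Momentum, (S.card : ℝ) * ‖ξ S‖ ^ 2 := by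
  have h := tsum_norm_annihilate (fun _ => True) ξ
  simp only [Finset.filter_true] at h
  rw [← h, numberForm]
  exact ((Equiv.subtypeUnivEquiv fun _ : Momentum => trivial).tsum_eq
    fun p => ‖annihilate p ξ‖ ^ 2).symm

open Classical in
lemma gappedNumberForm_eq (kF δ : ℝ) (ξ : Fock) :
    gappedNumberForm kF δ ξ =
      ∑' S : Finset Momentum, ((S.filter (IsGapped kF δ)).card : ℝ) * ‖ξ S‖ ^ 2 :=
  tsum_norm_annihilate (IsGapped kF δ) ξ

lemma card_le_of_mem_balancedSector {kF : ℝ} {ξ : Fock} (hξ : ξ ∈ balancedSector kF)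
    {S : Finset Momentum} (hS : ξ S ≠ 0) : S.card ≤ 2 * particleNumber kF := by
  have h1 := hξ S hS
  have h2 := Finset.card_filter_add_card_filter_not (s := S) (fun p => p ∈ fermiBall kF)
  have h3 : (S.filter (fun p => p ∈ fermiBall kF)).card ≤ particleNumber kF :=
    Finset.card_le_card fun p hp => (Finset.mem_filter.1 hp).2
  omega

lemma summable_weight {kF : ℝ} {ξ : Fock} (hξ : ξ ∈ balancedSector kF) (c : Finset Momentum → ℝ)
    (hc : ∀ S, 0 ≤ c S) (f : ℕ → ℝ) (hf : Monotone f) (hcf : ∀ S, c S ≤ f S.card) :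
    Summable (fun S => c S * ‖ξ S‖ ^ 2) := by
  refine Summable.of_nonneg_of_le (fun S => mul_nonneg (hc S) (sq_nonneg _)) (fun S => ?_)
    ((summable_fock ξ).mul_left (f (2 * particleNumber kF)))
  by_cases hS : ξ S = 0
  · simp [hS]
  · gcongr
    exact (hcf S).trans (hf (card_le_of_mem_balancedSector hξ hS))

open Classical in
/-- Cauchy-Schwarz for the number operator and the gapped number operator. -/
lemma tsum_card_mul_gapped_le {kF : ℝ} {ξ : Fock} (hξ : ξ ∈ balancedSector kF) (δ : ℝ) :
    ∑' S : Finset Momentum, ((S.card : ℝ) * (S.filter (IsGapped kF δ)).card) * ‖ξ S‖ ^ 2 ≤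
      √(numberCubedForm ξ) * √(gappedNumberForm kF δ ξ) := by
  set s : Finset Momentum → ℝ := fun S => (S.card : ℝ) with hs
  set g : Finset Momentum → ℝ := fun S => ((S.filter (IsGapped kF δ)).card : ℝ) with hg
  have hs0 (S : Finset Momentum) : 0 ≤ s S := Nat.cast_nonneg _
  have hg0 (S : Finset Momentum) : 0 ≤ g S := Nat.cast_nonneg _
  have hgs (S : Finset Momentum) : g S ≤ s S := by
    simp only [hg, hs]
    exact_mod_cast Finset.card_filter_le _ _
  have hmono1 : Monotone (fun n : ℕ => (n : ℝ)) := Nat.mono_cast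
  have hsum1 : Summable (fun S => (s S + 1) ^ 3 * ‖ξ S‖ ^ 2) :=
    summable_weight hξ _ (fun S => by have := hs0 S; positivity) (fun n => ((n : ℝ) + 1) ^ 3)
      (fun a b h => by
        have : (a : ℝ) ≤ b := by exact_mod_cast h
        simp only
        gcongr) (fun S => le_rfl)
  have hsum2 : Summable (fun S => g S * ‖ξ S‖ ^ 2) :=
    summable_weight hξ _ hg0 _ hmono1 hgs
  have e1 (S : Finset Momentum) : (√((s S + 1) ^ 3) * ‖ξ S‖) ^ (2 : ℝ) =
      (s S + 1) ^ 3 * ‖ξ S‖ ^ 2 := by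
    have := hs0 S
    rw [Real.rpow_two, mul_pow, Real.sq_sqrt (by positivity)]
  have e2 (S : Finset Momentum) : (√(g S) * ‖ξ S‖) ^ (2 : ℝ) = g S * ‖ξ S‖ ^ 2 := by
    rw [Real.rpow_two, mul_pow, Real.sq_sqrt (hg0 S)]
  obtain ⟨h1, h2⟩ := Real.summable_and_inner_le_Lp_mul_Lq_tsum_of_nonneg
    (Real.HolderConjugate.two_two) (f := fun S => √((s S + 1) ^ 3) * ‖ξ S‖)
    (g := fun S => √(g S) * ‖ξ S‖) (fun S => by positivity) (fun S => by positivity)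
    (by simpa only [e1] using hsum1) (by simpa only [e2] using hsum2)
  simp only [e1, e2] at h2
  rw [← Real.sqrt_eq_rpow, ← Real.sqrt_eq_rpow] at h2
  rw [gappedNumberForm_eq, numberCubedForm]
  refine le_trans ?_ h2
  have hle (S : Finset Momentum) : (s S * g S) * ‖ξ S‖ ^ 2 ≤
      √((s S + 1) ^ 3) * ‖ξ S‖ * (√(g S) * ‖ξ S‖) := by
    have h3 : s S * g S ≤ √((s S + 1) ^ 3) * √(g S) := by
      rw [← Real.sqrt_mul (by have := hs0 S; positivity)]
      apply Real.le_sqrt_of_sq_le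
      have f1 : s S ^ 2 * g S ≤ (s S + 1) ^ 3 := by nlinarith [hs0 S, hgs S, hg0 S, sq_nonneg (s S)]
      nlinarith [hg0 S]
    calc _ ≤ (√((s S + 1) ^ 3) * √(g S)) * ‖ξ S‖ ^ 2 := by gcongr
      _ = _ := by ring
  exact Summable.tsum_le_tsum hle (Summable.of_nonneg_of_le (fun S =>
    mul_nonneg (mul_nonneg (hs0 S) (hg0 S)) (sq_nonneg _)) hle h1) h1

/-! ### The non-bosonizable operators on the balanced sector -/

lemma nonBosonizableFun_zero {kF : ℝ} {ξ : Fock} (hξ : ξ ∈ balancedSector kF) :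
    nonBosonizableFun kF 0 ξ = 0 := by
  classical
  funext S
  rw [nonBosonizableFun_eq]
  have hhop : ∀ q ∈ S, hop 0 ξ q S = ξ S := by
    intro q hq
    rw [hop, add_zero, create_annihilate_apply, if_pos hq]
  simp only [neg_zero, add_zero, and_self]
  rw [Finset.sum_congr rfl (fun q hq => hhop q (Finset.mem_filter.1 hq).1),
    Finset.sum_congr rfl (fun q hq => hhop q (Finset.mem_filter.1 hq).1), Finset.sum_const,
    Finset.sum_const]
  by_cases hS : ξ S = 0
  · simp [hS]
  · have := hξ S hS
    rw [Pi.zero_apply, sub_eq_zero]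
    congr 1
    convert! this.symm using 2

open Classical in
/-- The operators `d(k)` on the balanced sector. -/
lemma norm_nonBosonizable_sq_le {kF : ℝ} {ξ : Fock} (hξ : ξ ∈ balancedSector kF) (δ : ℝ)
    (k : Momentum) (n : ℕ)
    (hn : k ≠ 0 → ∀ F : Finset Momentum,
      (∀ q ∈ F, ¬ IsGapped kF δ q ∧ ¬ IsGapped kF δ (q - k)) → F.card ≤ n) :
    ξ ∈ nonBosonizableDomain kF k ∧ ‖nonBosonizable kF k ξ‖ ^ 2 ≤
      48 * (√(numberCubedForm ξ) * √(gappedNumberForm kF δ ξ) + (n + 1) * numberForm ξ) := by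
  have hnum : 0 ≤ numberForm ξ := tsum_nonneg fun p => sq_nonneg _
  rcases eq_or_ne k 0 with rfl | hk
  · have h0 := nonBosonizableFun_zero hξ
    have hmem : Memℓp (nonBosonizableFun kF 0 ξ) 2 := by
      rw [h0]; exact zero_memℓp
    refine ⟨hmem, ?_⟩
    have : nonBosonizable kF 0 ξ = 0 := by
      rw [nonBosonizable, dif_pos hmem]
      ext S
      change nonBosonizableFun kF 0 ξ S = 0
      rw [h0]; rfl
    rw [this]
    simp only [norm_zero, ne_eq, OfNat.ofNat_ne_zero, not_false_eq_true, zero_pow]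
    positivity
  set G := IsGapped kF δ with hG
  set c : Finset Momentum → ℕ := fun T => T.card * (T.filter G).card + (n + 1) * T.card with hc
  set W := ∑' T : Finset Momentum, (c T : ENNReal) * esq (ξ T) with hW
  have hn1 : ∀ F : Finset Momentum, (∀ q ∈ F, ¬ G q ∧ ¬ G (q + k)) → F.card ≤ n := by
    intro F hF
    rw [← Finset.card_image_of_injective F (add_left_injective k)]
    refine hn hk _ fun q hq => ?_
    obtain ⟨p, hp, rfl⟩ := Finset.mem_image.1 hq
    simp only [add_sub_cancel_right]
    exact (hF p hp).symm
  have hn2 : ∀ F : Finset Momentum, (∀ q ∈ F, ¬ G q ∧ ¬ G (q + -k)) → F.card ≤ n := by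
    intro F hF
    refine hn hk F fun q hq => ?_
    rw [sub_eq_add_neg]
    exact hF q hq
  have h1 := tsum_esq_hop_le_gapped hk ξ (fun q => q ∉ fermiBall kF ∧ q + k ∉ fermiBall kF) G n hn1
  have h2 := tsum_esq_hop_le_gapped (neg_ne_zero.2 hk) ξ
    (fun q => q ∈ fermiBall kF ∧ q + -k ∈ fermiBall kF) G n hn2
  have h3 : ∑' S, esq (nonBosonizableFun kF k ξ S) ≤ 48 * W := by
    calc ∑' S, esq (nonBosonizableFun kF k ξ S) ≤ ∑' S, 2 * (esq (∑ q ∈ S with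
          (q ∉ fermiBall kF ∧ q + k ∉ fermiBall kF), hop k ξ q S) + esq (∑ q ∈ S with
          (q ∈ fermiBall kF ∧ q + -k ∈ fermiBall kF), hop (-k) ξ q S)) := by
          refine ENNReal.tsum_le_tsum fun S => ?_
          rw [nonBosonizableFun_eq, sub_eq_add_neg]
          refine (esq_add_le _ _).trans (le_of_eq ?_)
          rw [esq_neg]
      _ ≤ 2 * (12 * W + 12 * W) := by
          rw [ENNReal.tsum_mul_left, ENNReal.tsum_add]
          gcongr
      _ = 48 * W := by rw [← add_mul, ← mul_assoc]; norm_num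
  have hcsum : Summable (fun T => (c T : ℝ) * ‖ξ T‖ ^ 2) := by
    refine summable_weight hξ _ (fun S => Nat.cast_nonneg _)
      (fun m => ((m * m + (n + 1) * m : ℕ) : ℝ)) (fun a b h => ?_) fun S => ?_
    · simp only
      gcongr
    · simp only [hc]
      gcongr
      exact Finset.filter_subset _ _
  have hWr : W = ENNReal.ofReal (∑' T, (c T : ℝ) * ‖ξ T‖ ^ 2) := by
    rw [ENNReal.ofReal_tsum_of_nonneg (fun T => by positivity) hcsum]
    refine tsum_congr fun T => ?_
    rw [ENNReal.ofReal_mul (Nat.cast_nonneg _), ENNReal.ofReal_natCast, esq]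
  have hfin : ∑' S, esq (nonBosonizableFun kF k ξ S) ≠ ⊤ := by
    refine ne_top_of_le_ne_top ?_ h3
    rw [hWr]
    exact ENNReal.mul_ne_top (by norm_num) ENNReal.ofReal_ne_top
  have hsum : Summable (fun S => ‖nonBosonizableFun kF k ξ S‖ ^ 2) := by
    have := ENNReal.summable_toReal hfin
    refine this.congr fun S => ?_
    rw [esq, ENNReal.toReal_ofReal (sq_nonneg _)]
  have hmem : Memℓp (nonBosonizableFun kF k ξ) 2 := memℓp_two hsum
  refine ⟨hmem, ?_⟩
  have hW0 : 0 ≤ ∑' T, (c T : ℝ) * ‖ξ T‖ ^ 2 := tsum_nonneg fun T => by positivity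
  have hnorm : ‖nonBosonizable kF k ξ‖ ^ 2 = ∑' S, ‖nonBosonizableFun kF k ξ S‖ ^ 2 := by
    rw [nonBosonizable, dif_pos hmem, norm_sq_fock]
  have h4 : ‖nonBosonizable kF k ξ‖ ^ 2 ≤ 48 * ∑' T, (c T : ℝ) * ‖ξ T‖ ^ 2 := by
    rw [hnorm]
    have h5 : ENNReal.ofReal (∑' S, ‖nonBosonizableFun kF k ξ S‖ ^ 2) ≤
        ENNReal.ofReal (48 * ∑' T, (c T : ℝ) * ‖ξ T‖ ^ 2) := by
      rw [ENNReal.ofReal_tsum_of_nonneg (fun T => by positivity) hsum,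
        ENNReal.ofReal_mul (by norm_num), ← hWr]
      rw [show ENNReal.ofReal 48 = 48 by simp]
      exact h3
    exact (ENNReal.ofReal_le_ofReal_iff (by positivity)).1 h5
  refine h4.trans ?_
  have hs1 : Summable (fun T : Finset Momentum =>
      ((T.card : ℝ) * (T.filter G).card) * ‖ξ T‖ ^ 2) := by
    refine summable_weight hξ _ (fun S => by positivity) (fun m => (m : ℝ) * m)
      (fun a b h => ?_) fun S => ?_
    · simp only
      gcongr
    · gcongr
      exact Finset.filter_subset G S
  have hs2 : Summable (fun T : Finset Momentum => (T.card : ℝ) * ‖ξ T‖ ^ 2) :=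
    summable_weight hξ _ (fun S => Nat.cast_nonneg _) (fun m => (m : ℝ))
      Nat.mono_cast fun S => le_rfl
  have h6 : ∑' T, (c T : ℝ) * ‖ξ T‖ ^ 2 =
      ∑' T : Finset Momentum, ((T.card : ℝ) * (T.filter G).card) * ‖ξ T‖ ^ 2 +
        (n + 1) * numberForm ξ := by
    rw [numberForm_eq, ← tsum_mul_left, ← hs1.tsum_add (hs2.mul_left _)]
    refine tsum_congr fun T => ?_
    simp only [hc]
    push_cast
    ring
  rw [h6]
  gcongr
  exact tsum_card_mul_gapped_le hξ δ

/-- The lower bound on the balanced sector. -/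
lemma exists_E1Form_add_E2Form_ge {γ ε : ℝ} (hγ : 131 / 208 < γ) (hε : 0 < ε) (hε' : ε < 1 / 10)
    (V : Momentum → ℝ) (hV : Summable V) (hV0 : ∀ k, 0 ≤ V k) :
    ∃ C : ℝ, 0 < C ∧ ∀ kF : ℝ, 0 < kF →
      ∀ ξ : Fock, ξ ∈ balancedSector kF → ξ ∈ kineticDomain kF →
        ξ ∈ E1Domain V kF ∧
        Summable (fun k => V k * couplingForm kF k ξ) ∧
        E1Form V kF ξ + E2Form V kF ξ ≥
          -(C * (particleNumber kF : ℝ) ^ (-1 + ε / 4) * √(numberCubedForm ξ)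
              * √(gappedNumberForm kF (1 / 3 - ε) ξ))
          - C * (particleNumber kF : ℝ) ^ (5 * ε / 4 + γ / 3 - 1) * numberForm ξ
          - C * (particleNumber kF : ℝ) ^ (-(ε / 4)) * kineticForm kF ξ := by
  obtain ⟨C₁, hC₁, hE2⟩ := exists_E2Form_le V hV hV0
  obtain ⟨C₂, hC₂, hnear⟩ := exists_card_near_le hε (by linarith : ε ≤ 1 / 3)
    (by norm_num : (0 : ℝ) < 1 / 10)
  set v := ∑' k, V k with hv
  have hv0 : 0 ≤ v := tsum_nonneg hV0
  refine ⟨24 * v * (C₂ + 1) + C₁, by positivity, ?_⟩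
  intro kF h0 ξ hξ hkin
  have hN : (0 : ℝ) < particleNumber kF := by exact_mod_cast one_le_particleNumber h0
  have hN1 : (1 : ℝ) ≤ particleNumber kF := by exact_mod_cast one_le_particleNumber h0
  have hd := fun k => norm_nonBosonizable_sq_le hξ (1 / 3 - ε) k
    ⌊C₂ * (particleNumber kF : ℝ) ^ (2 * ε + 1 / 10)⌋₊
    (fun hk F hF => Nat.le_floor (hnear kF h0 k hk F hF))
  have hfl := Nat.floor_le (a := C₂ * (particleNumber kF : ℝ) ^ (2 * ε + 1 / 10)) (by positivity)
  set n := ⌊C₂ * (particleNumber kF : ℝ) ^ (2 * ε + 1 / 10)⌋₊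
  set A := √(numberCubedForm ξ) * √(gappedNumberForm kF (1 / 3 - ε) ξ) with hA
  set B := numberForm ξ with hB
  have hA0 : 0 ≤ A := by positivity
  have hB0 : 0 ≤ B := tsum_nonneg fun p => sq_nonneg _
  have hK := kineticForm_nonneg kF ξ
  set N := (particleNumber kF : ℝ) with hNdef
  have hn : (n + 1 : ℝ) ≤ (C₂ + 1) * N ^ (2 * ε + 1 / 10) := by
    have : 1 ≤ N ^ (2 * ε + 1 / 10) := Real.one_le_rpow hN1 (by positivity)
    linarith
  have hle (k : Momentum) : V k * ‖nonBosonizable kF k ξ‖ ^ 2 ≤ V k * (48 * (A + (n + 1) * B)) :=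
    mul_le_mul_of_nonneg_left (hd k).2 (hV0 k)
  have hsum : Summable (fun k => V k * ‖nonBosonizable kF k ξ‖ ^ 2) :=
    Summable.of_nonneg_of_le (fun k => mul_nonneg (hV0 k) (sq_nonneg _)) hle (hV.mul_right _)
  have hdom : ξ ∈ E1Domain V kF := ⟨fun k _ => (hd k).1, hsum⟩
  obtain ⟨h1, h2⟩ := hE2 kF h0 (ε / 4) ξ hdom hkin
  refine ⟨hdom, h1, ?_⟩
  have hE1 : E1Form V kF ξ ≤ 24 * v * (A + (C₂ + 1) * N ^ (2 * ε + 1 / 10) * B) * N ^ (-1 : ℝ) := by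
    have h3 : ∑' k, V k * ‖nonBosonizable kF k ξ‖ ^ 2 ≤ v * (48 * (A + (n + 1) * B)) := by
      rw [hv, ← tsum_mul_right]
      exact hsum.tsum_le_tsum hle (hV.mul_right _)
    rw [E1Form, Real.rpow_neg_one]
    calc _ ≤ 1 / (2 * N) * (v * (48 * (A + (n + 1) * B))) := by gcongr
      _ ≤ 1 / (2 * N) * (v * (48 * (A + (C₂ + 1) * N ^ (2 * ε + 1 / 10) * B))) := by gcongr
      _ = _ := by ring
  have hE10 : 0 ≤ E1Form V kF ξ :=
    mul_nonneg (by positivity) (tsum_nonneg fun k => mul_nonneg (hV0 k) (sq_nonneg _))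
  have h4 : N ^ (ε / 4) * E1Form V kF ξ ≤ 24 * v * N ^ (-1 + ε / 4) * A +
      24 * v * (C₂ + 1) * N ^ (5 * ε / 4 + γ / 3 - 1) * B := by
    have e1 : N ^ (ε / 4) * N ^ (-1 : ℝ) = N ^ (-1 + ε / 4) := by
      rw [← Real.rpow_add hN, add_comm]
    have e2 : N ^ (-1 + ε / 4) * N ^ (2 * ε + 1 / 10) ≤ N ^ (5 * ε / 4 + γ / 3 - 1) := by
      rw [← Real.rpow_add hN]
      exact Real.rpow_le_rpow_of_exponent_le hN1 (by linarith)
    calc N ^ (ε / 4) * E1Form V kF ξ ≤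
          N ^ (ε / 4) * (24 * v * (A + (C₂ + 1) * N ^ (2 * ε + 1 / 10) * B) * N ^ (-1 : ℝ)) := by
          gcongr
      _ = 24 * v * (N ^ (ε / 4) * N ^ (-1 : ℝ)) * A + 24 * v * (C₂ + 1) *
          ((N ^ (ε / 4) * N ^ (-1 : ℝ)) * N ^ (2 * ε + 1 / 10)) * B := by ring
      _ ≤ _ := by
          rw [e1]
          gcongr
  have h5 := (abs_le.1 h2).1
  have h6 : 0 < N ^ (-1 + ε / 4) := Real.rpow_pos_of_pos hN _
  have h7 : 0 < N ^ (5 * ε / 4 + γ / 3 - 1) := Real.rpow_pos_of_pos hN _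
  have h8 : 0 < N ^ (-(ε / 4)) := Real.rpow_pos_of_pos hN _
  have f1 : 24 * v * N ^ (-1 + ε / 4) * A ≤
      (24 * v * (C₂ + 1) + C₁) * N ^ (-1 + ε / 4) * A := by
    gcongr
    nlinarith [mul_nonneg hv0 hC₂.le]
  have f2 : 24 * v * (C₂ + 1) * N ^ (5 * ε / 4 + γ / 3 - 1) * B ≤
      (24 * v * (C₂ + 1) + C₁) * N ^ (5 * ε / 4 + γ / 3 - 1) * B := by
    gcongr
    linarith
  have f3 : C₁ * N ^ (-(ε / 4)) * kineticForm kF ξ ≤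
      (24 * v * (C₂ + 1) + C₁) * N ^ (-(ε / 4)) * kineticForm kF ξ := by
    gcongr
    have : 0 ≤ 24 * v * (C₂ + 1) := by positivity
    linarith
  rw [mul_assoc _ (√(numberCubedForm ξ)), ← hA]
  linarith

end FermiGas

end
open FermiGas in
theorem corollary4p7 :
    (∀ V : Momentum → ℝ, Summable V → (∀ k, 0 ≤ V k) →
      ∃ C : ℝ, 0 < C ∧ ∀ kF : ℝ, 0 < kF → ∀ α : ℝ, 0 ≤ α →
        ∀ ξ : Fock, ξ ∈ E1Domain V kF → ξ ∈ kineticDomain kF →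
          Summable (fun k => V k * couplingForm kF k ξ) ∧
          E2Form V kF ξ ≤ (particleNumber kF : ℝ) ^ α * E1Form V kF ξ
            + C * (particleNumber kF : ℝ) ^ (-α) * kineticForm kF ξ ∧
          -E2Form V kF ξ ≤ (particleNumber kF : ℝ) ^ α * E1Form V kF ξ
            + C * (particleNumber kF : ℝ) ^ (-α) * kineticForm kF ξ) ∧
    (∀ γ : ℝ, 131 / 208 < γ → γ < 1 →
      ∃ ε₀ : ℝ, 0 < ε₀ ∧ ∀ ε : ℝ, 0 < ε → ε < ε₀ →
        ∀ V : Momentum → ℝ, Summable V → (∀ k, 0 ≤ V k) →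
          ∃ C : ℝ, 0 < C ∧ ∀ kF : ℝ, 0 < kF →
            ∀ ξ : Fock, ξ ∈ balancedSector kF → ξ ∈ kineticDomain kF →
              ξ ∈ E1Domain V kF ∧
              Summable (fun k => V k * couplingForm kF k ξ) ∧
              E1Form V kF ξ + E2Form V kF ξ ≥
                -(C * (particleNumber kF : ℝ) ^ (-1 + ε / 4) * √(numberCubedForm ξ)
                    * √(gappedNumberForm kF (1 / 3 - ε) ξ))
                - C * (particleNumber kF : ℝ) ^ (5 * ε / 4 + γ / 3 - 1) * numberForm ξ
                - C * (particleNumber kF : ℝ) ^ (-(ε / 4)) * kineticForm kF ξ) := by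
  refine ⟨fun V hV hV0 => ?_, fun γ hγ _ => ⟨1 / 10, by norm_num, fun ε hε hε' V hV hV0 =>
    exists_E1Form_add_E2Form_ge hγ hε hε' V hV hV0⟩⟩
  obtain ⟨C, hC, h⟩ := exists_E2Form_le V hV hV0
  refine ⟨C, hC, fun kF h0 α _ ξ h1 h2 => ?_⟩
  obtain ⟨h3, h4⟩ := h kF h0 α ξ h1 h2
  exact ⟨h3, (le_abs_self _).trans h4, (neg_le_abs _).trans h4⟩
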